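/- Let $\gamma$ be the standard Gaussian measure on $\mathbb{R}^n$. For $\lambda>0$ let $\mathcal{P}(\lambda)$ be the class of Borel probability measures $\nu$ on $\mathbb{R}^n$ such that $\lambda\int g^2\,d\nu\le\int|\nabla g|^2\,d\nu$ for every smooth $\nu$-integrable $g:\mathbb{R}^n\to\mathbb{R}$ with $\int g\,d\nu=0$ (both integrals taken in $[0,\infty]$). For a probability measure $d\nu=f\,d\gamma$ with density $f\ge 0$ let $$\mathrm{H}(\nu)=\int_{\mathbb{R}^n} f\log f\,d\gamma,\qquad \mathrm{I}(\nu)=\int_{\mathbb{R}^n}\frac{|\nabla f|^2}{f}\,d\gamma,\qquad \delta_{\rm LSI}(\nu)=\tfrac12\,\mathrm{I}(\nu)-\mathrm{H}(\nu),$$ where $\nabla f$ is the weak gradient of $f$ (with $\mathrm{I}(\nu)=\infty$ if $f$ has no locally integrable weak gradient, and $0/0=0$). Put $$c(\lambda)=\frac{1-\lambda+\lambda\log\lambda}{(1-\lambda)^2}\quad(\lambda\ne1),\qquad c(1)=\tfrac12,\qquad c_1(\lambda)=\tfrac12\bigl(1-c(\lambda)\bigr).$$ **Corollary.** Let $d\nu=f\,d\gamma$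 be a probability measure in $\mathcal{P}(\lambda)$, $\lambda>0$, that is centered ($\int x\,d\nu=0$) and has $\mathrm{I}(\nu)<\infty$. Then $f\log f$ is $\gamma$-integrable and $$\delta_{\rm LSI}(\nu)\;\ge\;\frac{c_1(\lambda)}{4}\Bigl(\int_{\mathbb{R}^n}|f-1|\,d\gamma\Bigr)^2\;=\;\frac{c_1(\lambda)}{4}\,\|\nu-\gamma\|_{\rm TV}^2,$$ where $\|\nu-\gamma\|_{\rm TV}=|\nu-\gamma|(\mathbb{R}^n)$ is the total variation norm of the signed measure $\nu-\gamma$. -/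

import Mathlib

open MeasureTheory ProbabilityTheory
open scoped ENNReal ContDiff

noncomputable section

namespace GaussianLSI

/-- Euclidean space `ℝⁿ`. -/
abbrev Euc (n : ℕ) : Type := EuclideanSpace ℝ (Fin n)

/-- `G` is a weak (distributional) gradient of `f` on `ℝⁿ`:
`f` and `G` are locally integrable for Lebesgue measure and `∫ f ∇φ dx = - ∫ φ G dx` for every
smooth compactly supported `φ`. -/
structure HasWeakGradient {n : ℕ} (f : Euc n → ℝ) (G : Euc n → Euc n) : Prop where
  locallyIntegrable : LocallyIntegrable f volume
  locallyIntegrable_grad : LocallyIntegrable G volume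
  integral_smul_gradient : ∀ φ : Euc n → ℝ, ContDiff ℝ ∞ φ → HasCompactSupport φ →
    ∫ x, f x • gradient φ x = - ∫ x, φ x • G x

/-- The Fisher information `∫ |∇f|² / f dγ ∈ [0, ∞]` relative to the standard Gaussian measure
of the measure with density `f ≥ 0`. The weak gradient is almost everywhere unique when it exists,
so the infimum below is the value at that gradient; it is `∞` if there is no weak gradient. In the
quotient `0 / 0 = 0` and `a / 0 = ∞` for `a > 0`. -/
def fisherInfo {n : ℕ} (f : Euc n → ℝ) : ℝ≥0∞ :=
  ⨅ (G : Euc n → Euc n) (_ : HasWeakGradient f G),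
    ∫⁻ x, ‖G x‖ₑ ^ 2 / ENNReal.ofReal (f x) ∂(stdGaussian (Euc n))

/-- The relative entropy `∫ f log f dγ` (a real number, meaningful if `f log f` is integrable). -/
def entropy {n : ℕ} (f : Euc n → ℝ) : ℝ :=
  ∫ x, f x * Real.log (f x) ∂(stdGaussian (Euc n))

/-- The logarithmic Sobolev deficit `I / 2 - H` (meaningful if both terms are finite). -/
def lsiDeficit {n : ℕ} (f : Euc n → ℝ) : ℝ :=
  (1 / 2) * (fisherInfo f).toReal - entropy f

/-- The class `P(l)`: the probability measures on `ℝⁿ` that satisfy the Poincaré inequality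
with constant `l > 0`, `l ∫ g² dν ≤ ∫ |∇g|² dν` for every smooth `g` with `∫ g dν = 0`
(the two integrals are taken in `[0, ∞]`). -/
structure MemPoincareClass {n : ℕ} (l : ℝ) (ν : Measure (Euc n)) : Prop where
  pos : 0 < l
  isProbabilityMeasure : IsProbabilityMeasure ν
  poincare : ∀ g : Euc n → ℝ, ContDiff ℝ ∞ g → Integrable g ν → ∫ x, g x ∂ν = 0 →
    ENNReal.ofReal l * ∫⁻ x, ‖g x‖ₑ ^ 2 ∂ν ≤ ∫⁻ x, ‖gradient g x‖ₑ ^ 2 ∂ν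

/-- `ν` is centered: its barycenter exists and is the origin. -/
structure IsCentered {n : ℕ} (ν : Measure (Euc n)) : Prop where
  integrable : Integrable (fun x : Euc n => x) ν
  integral_eq_zero : ∫ x, x ∂ν = 0

/-- `c(l) = (1 - l + l log l) / (1 - l)²`, with `c(1) = 1 / 2`. -/
def lsiConst (l : ℝ) : ℝ :=
  if l = 1 then 1 / 2 else (1 - l + l * Real.log l) / (1 - l) ^ 2

/-- `c₁(l) = (1 - c(l)) / 2`. -/
def lsiConstOne (l : ℝ) : ℝ := (1 / 2) * (1 - lsiConst l)

/-- The total variation norm `|s|(ℝⁿ)` of a signed measure `s`. -/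
def tvNorm {n : ℕ} (s : SignedMeasure (Euc n)) : ℝ := (s.totalVariation Set.univ).toReal

end GaussianLSI

end

/-! The heart is the improved logarithmic Sobolev inequality `H ≤ (c(l)/2) I` for centered measures
in `P(l)`. Since `c(l) ≤ 1`, it gives both `δ ≥ c₁(l) I` and `H ≤ I/2`. A Pinsker type bound `T² ≤ 4
H`, with `T = ∫ |f - 1| dγ`, then yields `T² ≤ 4 I`, and the claim follows.

The improved inequality is proved in dual form: `∫ log h dν ≤ log ∫ h dγ + (c(l)/2) I` for smooth
bounded `h` with a positive lower bound. Let `P_t` be the Ornstein–Uhlenbeck semigroup with `e^{-t}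
= cos θ`. The function `interp` is `∫ P_t (log P_t h) dν`: it equals `∫ log h dν` at `θ = 0` and
`log ∫ h dγ` at `θ = π/2`. Its derivative (`HasFiniteInfo.hasDerivAt_interp`) involves only first
derivatives of `F = log P_t h` and the weak gradient `G` of `f`, because integration by parts
removes all second derivatives.

Each coordinate of that derivative is bounded in `coordinate_bound`. Bessel's inequality gives a
reverse Poincaré inequality: averaging `u²` exceeds the square of the average `w` of `u` by a
multiple of `|∇w|²`. The Poincaré inequality of `ν` turns this excess into a multiple of the
variance of `w`. Centering makes `∫ G dγ = 0`, so only `w` minus its mean is paired with `G`, and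
Cauchy–Schwarz gains the factor `1 / (1 + l tan² θ)`. Integrating in `θ`, with `u = cos² θ`,
produces exactly `c(l)/2` (`exists_primitive`).

Finally `h` is replaced by `f`: mollification admits bounded measurable `g` of compact support in `ε
+ g`, truncations of `f` increase to `f`, and `ε → 0`. -/

namespace GaussianLSI

open Filter Topology

variable {n : ℕ}

/-! ### The density of the standard Gaussian measure -/

/-- The normalizing constant of the standard Gaussian density. -/
noncomputable def gaussNorm (n : ℕ) : ℝ := ∫ x : Euc n, Real.exp (-(‖x‖ ^ 2) / 2)

/-- The Lebesgue density of the standard Gaussian measure. -/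
noncomputable def gaussDensity (x : Euc n) : ℝ := (gaussNorm n)⁻¹ * Real.exp (-(‖x‖ ^ 2) / 2)

lemma integrable_exp_neg_sq_norm : Integrable (fun x : Euc n => Real.exp (-(‖x‖ ^ 2) / 2)) := by
  have h := GaussianFourier.integrable_cexp_neg_mul_sq_norm_add (V := Euc n) (b := 1 / 2)
    (by norm_num) 0 0
  refine h.norm.congr (Eventually.of_forall fun x => ?_)
  simp only [Complex.norm_exp]
  congr 1
  have : (-(1 / 2 : ℂ) * (‖x‖ : ℂ) ^ 2 + 0 * ((inner ℝ (0 : Euc n) x : ℝ) : ℂ)) =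
      ((-(‖x‖ ^ 2) / 2 : ℝ) : ℂ) := by push_cast; ring
  rw [this, Complex.ofReal_re]

lemma gaussNorm_pos : 0 < gaussNorm n := by
  have := integral_pos_iff_support_of_nonneg (μ := (volume : Measure (Euc n)))
    (f := fun x : Euc n => Real.exp (-(‖x‖ ^ 2) / 2)) (fun x => (Real.exp_pos _).le)
    integrable_exp_neg_sq_norm
  rw [gaussNorm, this]
  have hs : Function.support (fun x : Euc n => Real.exp (-(‖x‖ ^ 2) / 2)) = Set.univ := by
    ext x; simp [(Real.exp_pos _).ne']
  rw [hs]
  exact (isOpen_univ.measure_pos volume Set.univ_nonempty)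

lemma gaussDensity_pos (x : Euc n) : 0 < gaussDensity x :=
  mul_pos (inv_pos.2 gaussNorm_pos) (Real.exp_pos _)

lemma integrable_gaussDensity : Integrable (gaussDensity : Euc n → ℝ) :=
  integrable_exp_neg_sq_norm.const_mul _

lemma contDiff_gaussDensity : ContDiff ℝ ∞ (gaussDensity : Euc n → ℝ) := by
  unfold gaussDensity
  exact contDiff_const.mul (((contDiff_norm_sq ℝ).neg.div_const 2).exp)

lemma measurable_gaussDensity : Measurable (gaussDensity : Euc n → ℝ) :=
  contDiff_gaussDensity.continuous.measurable

/-- The standard Gaussian measure. -/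
noncomputable abbrev gauss (n : ℕ) : Measure (Euc n) := stdGaussian (Euc n)

/-- Both finite measures have the same Fourier transform. -/
lemma gauss_eq_withDensity :
    gauss n = volume.withDensity (fun x => ENNReal.ofReal (gaussDensity x)) := by
  have hfin : IsFiniteMeasure
      ((volume : Measure (Euc n)).withDensity (fun x => ENNReal.ofReal (gaussDensity x))) :=
    isFiniteMeasure_withDensity_ofReal integrable_gaussDensity.2
  apply Measure.ext_of_charFun
  ext t
  rw [charFun_stdGaussian, charFun_apply]
  rw [integral_withDensity_eq_integral_toReal_smul measurable_gaussDensity.ennreal_ofReal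
    (Eventually.of_forall fun x => ENNReal.ofReal_lt_top)]
  have h1 := GaussianFourier.integral_cexp_neg_mul_sq_norm_add (V := Euc n) (b := 1 / 2)
    (by norm_num) Complex.I t
  have h0 := GaussianFourier.integral_cexp_neg_mul_sq_norm_add (V := Euc n) (b := 1 / 2)
    (by norm_num) 0 0
  -- The normalizing constant is the same Gaussian integral at frequency `0`, so it cancels in the
  -- Fourier transform.
  have hK : ((gaussNorm n : ℝ) : ℂ) = ((Real.pi : ℂ) / (1 / 2 : ℂ)) ^
      (Module.finrank ℝ (Euc n) / 2 : ℂ) := by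
    rw [gaussNorm, ← integral_complex_ofReal]
    simp only [zero_mul, add_zero] at h0
    have : Complex.exp (0 ^ 2 * (‖(0 : Euc n)‖ : ℂ) ^ 2 / (4 * (1 / 2))) = 1 := by simp
    rw [this, mul_one] at h0
    rw [← h0]
    congr 1
    ext x
    push_cast
    congr 1
    ring
  rw [← hK] at h1
  have e : ∀ x : Euc n, (ENNReal.ofReal (gaussDensity x)).toReal •
      Complex.exp (((inner ℝ x t : ℝ) : ℂ) * Complex.I) =
      ((gaussNorm n : ℝ) : ℂ)⁻¹ *
        Complex.exp (-(1 / 2 : ℂ) * (‖x‖ : ℂ) ^ 2 + Complex.I * ((inner ℝ t x : ℝ) : ℂ)) := by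
    intro x
    rw [ENNReal.toReal_ofReal (gaussDensity_pos x).le, gaussDensity, Complex.real_smul,
      real_inner_comm, Complex.exp_add]
    push_cast
    rw [mul_assoc]
    congr 3
    · ring
    · ring
  simp_rw [e]
  rw [integral_const_mul, h1, ← mul_assoc, inv_mul_cancel₀ (by exact_mod_cast gaussNorm_pos.ne'),
    one_mul]
  congr 1
  rw [Complex.I_sq]
  ring

lemma integral_gauss (φ : Euc n → ℝ) :
    ∫ x, φ x ∂(gauss n) = ∫ x, gaussDensity x * φ x := by
  rw [gauss_eq_withDensity, integral_withDensity_eq_integral_toReal_smul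
    measurable_gaussDensity.ennreal_ofReal
    (Eventually.of_forall fun x => ENNReal.ofReal_lt_top)]
  simp only [ENNReal.toReal_ofReal (gaussDensity_pos _).le, smul_eq_mul]

lemma gauss_absolutelyContinuous : gauss n ≪ (volume : Measure (Euc n)) := by
  rw [gauss_eq_withDensity]
  exact withDensity_absolutelyContinuous _ _

/-! ### Partial derivatives -/

/-- The `i`-th coordinate vector. -/
noncomputable abbrev basisVec (i : Fin n) : Euc n := EuclideanSpace.single i (1 : ℝ)

/-- The `i`-th partial derivative. -/
noncomputable def pderiv (i : Fin n) (φ : Euc n → ℝ) (x : Euc n) : ℝ := fderiv ℝ φ x (basisVec i)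

lemma gradient_apply (φ : Euc n → ℝ) (x : Euc n) (i : Fin n) :
    gradient φ x i = pderiv i φ x := by
  rw [pderiv, gradient]
  rw [← InnerProductSpace.toDual_symm_apply, EuclideanSpace.inner_single_right]
  simp

lemma fderiv_eq_sum (φ : Euc n → ℝ) (x v : Euc n) :
    fderiv ℝ φ x v = ∑ i, v i * pderiv i φ x := by
  have hv : v = ∑ i, v i • basisVec i := by
    ext j
    simp [Finset.sum_apply, Pi.single_apply]
  conv_lhs => rw [hv]
  simp [pderiv]

lemma norm_gradient_sq (φ : Euc n → ℝ) (x : Euc n) :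
    ‖gradient φ x‖ ^ 2 = ∑ i, (pderiv i φ x) ^ 2 := by
  rw [EuclideanSpace.real_norm_sq_eq]
  simp [gradient_apply]

lemma pderiv_gaussDensity (i : Fin n) (x : Euc n) :
    pderiv i gaussDensity x = -(x i) * gaussDensity x := by
  have h1 := (hasStrictFDerivAt_norm_sq x).hasFDerivAt
  have h2 := ((h1.const_mul (-1 / 2 : ℝ)).exp).const_mul (gaussNorm n)⁻¹
  have heq : (gaussDensity : Euc n → ℝ) =
      fun y => (gaussNorm n)⁻¹ * Real.exp (-1 / 2 * ‖y‖ ^ 2) := by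
    ext y
    simp only [gaussDensity]
    congr 2
    ring
  rw [pderiv, heq, h2.fderiv]
  simp [EuclideanSpace.inner_single_right]
  ring

/-! ### Smooth functions with bounded derivatives -/

/-- Smooth functions all of whose derivatives, including the function itself, are bounded. -/
def BddSmooth {G : Type} [NormedAddCommGroup G] [NormedSpace ℝ G] (F : Euc n → G) : Prop :=
  ContDiff ℝ ∞ F ∧ ∀ k : ℕ, ∃ C : ℝ, ∀ x, ‖iteratedFDeriv ℝ k F x‖ ≤ C

namespace BddSmooth

variable {G : Type} [NormedAddCommGroup G] [NormedSpace ℝ G] {F : Euc n → G}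

lemma contDiff (hF : BddSmooth F) : ContDiff ℝ ∞ F := hF.1

lemma continuous (hF : BddSmooth F) : Continuous F := hF.1.continuous

lemma differentiable (hF : BddSmooth F) : Differentiable ℝ F := hF.1.differentiable (by simp)

lemma bounded (hF : BddSmooth F) : ∃ C : ℝ, 0 ≤ C ∧ ∀ x, ‖F x‖ ≤ C := by
  obtain ⟨C, hC⟩ := hF.2 0
  simp only [norm_iteratedFDeriv_zero] at hC
  exact ⟨C, (norm_nonneg _).trans (hC 0), hC⟩

lemma fderiv (hF : BddSmooth F) : BddSmooth (fderiv ℝ F) := by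
  refine ⟨hF.1.fderiv_right (by simp), fun k => ?_⟩
  obtain ⟨C, hC⟩ := hF.2 (k + 1)
  exact ⟨C, fun x => by rw [norm_iteratedFDeriv_fderiv]; exact hC x⟩

lemma clm_comp {G' : Type} [NormedAddCommGroup G'] [NormedSpace ℝ G'] (L : G →L[ℝ] G')
    (hF : BddSmooth F) : BddSmooth (fun x => L (F x)) := by
  refine ⟨L.contDiff.comp hF.1, fun k => ?_⟩
  obtain ⟨C, hC⟩ := hF.2 k
  refine ⟨‖L‖ * C, fun x => ?_⟩
  refine (L.norm_iteratedFDeriv_comp_left hF.1.contDiffAt (n := k) ?_).trans ?_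
  · exact_mod_cast le_top
  · exact mul_le_mul_of_nonneg_left (hC x) (norm_nonneg _)

lemma pderiv {φ : Euc n → ℝ} (hφ : BddSmooth φ) (i : Fin n) : BddSmooth (pderiv i φ) :=
  hφ.fderiv.clm_comp (ContinuousLinearMap.apply ℝ ℝ (basisVec i))

lemma of_hasCompactSupport (hF : ContDiff ℝ ∞ F) (hc : HasCompactSupport F) : BddSmooth F := by
  refine ⟨hF, fun k => ?_⟩
  obtain ⟨C, hC⟩ := (hc.iteratedFDeriv (𝕜 := ℝ) k).exists_bound_of_continuous
    (hF.continuous_iteratedFDeriv (m := k) (by exact_mod_cast le_top))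
  exact ⟨C, hC⟩

lemma const_add (c : G) (hF : BddSmooth F) : BddSmooth (fun x => c + F x) := by
  refine ⟨contDiff_const.add hF.1, fun k => ?_⟩
  obtain ⟨C, hC⟩ := hF.2 k
  have hcc : ∀ x, ‖iteratedFDeriv ℝ k (fun _ : Euc n => c) x‖ ≤ ‖c‖ := by
    intro x
    rcases Nat.eq_zero_or_pos k with rfl | hk
    · simp
    · rw [iteratedFDeriv_const_of_ne hk.ne']; simp
  refine ⟨‖c‖ + C, fun x => ?_⟩
  have := iteratedFDeriv_add_apply (𝕜 := ℝ) (i := k) (f := fun _ : Euc n => c) (g := F) (x := x)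
    contDiff_const.contDiffAt (hF.1.contDiffAt.of_le (by exact_mod_cast le_top))
  change ‖iteratedFDeriv ℝ k ((fun _ => c) + F) x‖ ≤ _
  rw [this]
  exact (norm_add_le _ _).trans (add_le_add (hcc x) (hC x))

/-- The values of `φ` stay in a compact interval `[ε, M]` of the positive half-line, where every
derivative of the logarithm is bounded. The Faà di Bruno estimate then bounds each derivative of the
composition. -/
lemma log {φ : Euc n → ℝ} (hφ : BddSmooth φ) {ε : ℝ} (hε : 0 < ε) (hlow : ∀ x, ε ≤ φ x) :
    BddSmooth (fun x => Real.log (φ x)) := by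
  refine ⟨hφ.1.log fun x => (hε.trans_le (hlow x)).ne', fun k => ?_⟩
  obtain ⟨M, -, hM⟩ := hφ.bounded
  have hlog : ContDiffOn ℝ ∞ Real.log (Set.Ioi 0) := fun x hx =>
    (Real.contDiffAt_log.2 (ne_of_gt hx)).contDiffWithinAt
  have hB : ∀ i : ℕ, ∃ C, ∀ y ∈ Set.Icc ε M, ‖iteratedFDerivWithin ℝ i Real.log (Set.Ioi 0) y‖ ≤ C :=
    fun i => isCompact_Icc.exists_bound_of_continuousOn
      ((hlog.continuousOn_iteratedFDerivWithin (m := i) (by exact_mod_cast le_top)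
        (uniqueDiffOn_Ioi 0)).mono fun y hy => hε.trans_le hy.1)
  choose C hC using hB
  choose D hD using hφ.2
  refine ⟨(k.factorial : ℝ) * (∑ i ∈ Finset.range (k + 1), |C i|) *
    (1 + ∑ i ∈ Finset.range (k + 1), |D i|) ^ k, fun x => ?_⟩
  have h := norm_iteratedFDerivWithin_comp_le (𝕜 := ℝ) (n := k) (s := Set.univ) (t := Set.Ioi 0)
    (x := x) hlog hφ.1.contDiffOn (by exact_mod_cast le_top) (uniqueDiffOn_Ioi 0) uniqueDiffOn_univ
    (fun y _ => hε.trans_le (hlow y)) (Set.mem_univ x) (C := ∑ i ∈ Finset.range (k + 1), |C i|)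
    (D := 1 + ∑ i ∈ Finset.range (k + 1), |D i|) ?_ ?_
  · rwa [iteratedFDerivWithin_univ] at h
  · intro i hi
    refine (hC i _ ⟨hlow x, (le_abs_self _).trans (hM x)⟩).trans ((le_abs_self _).trans ?_)
    exact Finset.single_le_sum (f := fun i => |C i|) (fun _ _ => abs_nonneg _)
      (Finset.mem_range.2 (by omega))
  · intro i h1 hi
    rw [iteratedFDerivWithin_univ]
    have h2 : |D i| ≤ 1 + ∑ i ∈ Finset.range (k + 1), |D i| := by
      have := Finset.single_le_sum (s := Finset.range (k + 1)) (f := fun i => |D i|)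
        (fun _ _ => abs_nonneg _) (Finset.mem_range.2 (show i < k + 1 by omega))
      linarith
    have h3 : 1 ≤ 1 + ∑ i ∈ Finset.range (k + 1), |D i| := by
      linarith [Finset.sum_nonneg (s := Finset.range (k + 1)) (f := fun i => |D i|)
        fun _ _ => abs_nonneg _]
    exact (hD i x).trans ((le_abs_self _).trans (h2.trans (le_self_pow₀ h3 (by omega))))

end BddSmooth

/-! ### Gaussian averages -/

/-- The Gaussian average `x ↦ ∫ F (a x + b z) dγ(z)`. -/
noncomputable def gAvg {G : Type} [NormedAddCommGroup G] [NormedSpace ℝ G] (a b : ℝ)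
    (F : Euc n → G) (x : Euc n) : G := ∫ z, F (a • x + b • z) ∂(gauss n)

section

variable {G : Type} [NormedAddCommGroup G] [NormedSpace ℝ G] {F : Euc n → G}

lemma BddSmooth.integrable_comp (hF : BddSmooth F) {α : Type*} [MeasurableSpace α]
    {μ : Measure α} [IsFiniteMeasure μ] {g : α → Euc n} (hg : Measurable g) :
    Integrable (fun z => F (g z)) μ := by
  obtain ⟨C, -, hC⟩ := hF.bounded
  exact Integrable.of_bound (hF.continuous.stronglyMeasurable.comp_measurable hg).aestronglyMeasurable
    C (Eventually.of_forall fun z => hC _)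

lemma BddSmooth.integrable (hF : BddSmooth F) {μ : Measure (Euc n)} [IsFiniteMeasure μ] :
    Integrable F μ :=
  hF.integrable_comp measurable_id

lemma hasFDerivAt_gAvg (hF : BddSmooth F) (a b : ℝ) (x : Euc n) :
    HasFDerivAt (gAvg a b F) (a • gAvg a b (fderiv ℝ F) x) x := by
  have hF' := hF.fderiv
  obtain ⟨C, hC0, hC⟩ := hF'.bounded
  unfold gAvg
  rw [← integral_smul]
  refine hasFDerivAt_integral_of_dominated_of_fderiv_le (𝕜 := ℝ) (bound := fun _ => |a| * C)
    (F' := fun x z => a • fderiv ℝ F (a • x + b • z)) univ_mem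
    (Eventually.of_forall fun y => ?_) ?_ ?_ ?_ (integrable_const _) ?_
  · exact (hF.integrable_comp (by fun_prop)).aestronglyMeasurable
  · exact hF.integrable_comp (by fun_prop)
  · exact (hF'.integrable_comp (by fun_prop)).aestronglyMeasurable.const_smul a
  · refine Eventually.of_forall fun z y _ => ?_
    rw [norm_smul, Real.norm_eq_abs]
    exact mul_le_mul_of_nonneg_left (hC _) (abs_nonneg a)
  · refine Eventually.of_forall fun z y _ => ?_
    have h1 : HasFDerivAt (fun y : Euc n => a • y + b • z) (a • ContinuousLinearMap.id ℝ (Euc n)) y :=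
      ((hasFDerivAt_id y).const_smul a).add_const _
    have h2 := (hF.differentiable (a • y + b • z)).hasFDerivAt.comp y h1
    convert! h2 using 1
    ext v
    simp

/-- The target space is quantified inside the statement because the induction passes from `F` to
`fderiv ℝ F`, which takes values in another space. -/
lemma contDiff_gAvg_nat (a b : ℝ) (m : ℕ) : ∀ {G : Type} [NormedAddCommGroup G] [NormedSpace ℝ G]
    {F : Euc n → G}, BddSmooth F → ContDiff ℝ m (gAvg a b F) := by
  induction m with
  | zero =>
    intro G _ _ F hF
    rw [Nat.cast_zero, contDiff_zero]
    exact (Differentiable.continuous (𝕜 := ℝ) fun x => (hasFDerivAt_gAvg hF a b x).differentiableAt)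
  | succ m ih =>
    intro G _ _ F hF
    rw [Nat.cast_succ, contDiff_succ_iff_fderiv]
    refine ⟨fun x => (hasFDerivAt_gAvg hF a b x).differentiableAt, fun h => by simp at h, ?_⟩
    have : fderiv ℝ (gAvg a b F) = fun x => a • gAvg a b (fderiv ℝ F) x :=
      funext fun x => (hasFDerivAt_gAvg hF a b x).fderiv
    rw [this]
    exact (ih hF.fderiv).const_smul a

lemma bdd_iteratedFDeriv_gAvg (a b : ℝ) (k : ℕ) : ∀ {G : Type} [NormedAddCommGroup G]
    [NormedSpace ℝ G] {F : Euc n → G}, BddSmooth F →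
    ∃ C : ℝ, ∀ x, ‖iteratedFDeriv ℝ k (gAvg a b F) x‖ ≤ C := by
  induction k with
  | zero =>
    intro G _ _ F hF
    obtain ⟨C, hC0, hC⟩ := hF.bounded
    refine ⟨C, fun x => ?_⟩
    rw [norm_iteratedFDeriv_zero, gAvg]
    have := norm_integral_le_of_norm_le_const (μ := gauss n) (f := fun z => F (a • x + b • z))
      (C := C) (Eventually.of_forall fun z => hC _)
    simpa using this
  | succ k ih =>
    intro G _ _ F hF
    have : fderiv ℝ (gAvg a b F) = a • gAvg a b (fderiv ℝ F) :=
      funext fun x => (hasFDerivAt_gAvg hF a b x).fderiv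
    obtain ⟨C, hC⟩ := ih hF.fderiv
    refine ⟨‖a‖ * C, fun x => ?_⟩
    rw [← norm_iteratedFDeriv_fderiv, this, iteratedFDeriv_const_smul_apply
      (contDiff_gAvg_nat a b k hF.fderiv).contDiffAt, norm_smul]
    exact mul_le_mul_of_nonneg_left (hC x) (norm_nonneg a)

lemma BddSmooth.gAvg (hF : BddSmooth F) (a b : ℝ) : BddSmooth (gAvg a b F) :=
  ⟨contDiff_infty.2 fun m => contDiff_gAvg_nat a b m hF, fun k => bdd_iteratedFDeriv_gAvg a b k hF⟩

end

lemma pderiv_gAvg {φ : Euc n → ℝ} (hφ : BddSmooth φ) (a b : ℝ) (i : Fin n) (x : Euc n) :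
    pderiv i (gAvg a b φ) x = a * gAvg a b (pderiv i φ) x := by
  rw [pderiv, (hasFDerivAt_gAvg hφ a b x).fderiv]
  simp only [smul_apply, smul_eq_mul, gAvg, pderiv]
  rw [ContinuousLinearMap.integral_apply]
  exact hφ.fderiv.integrable_comp (by fun_prop)

lemma le_gAvg {φ : Euc n → ℝ} (hφ : BddSmooth φ) {ε : ℝ} (h : ∀ x, ε ≤ φ x) (a b : ℝ) (x : Euc n) :
    ε ≤ gAvg a b φ x := by
  have := integral_mono (μ := gauss n) (integrable_const ε)
    (hφ.integrable_comp (g := fun z => a • x + b • z) (by fun_prop)) fun z => h _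
  simpa [gAvg] using this

/-! ### Integration by parts -/

lemma integral_gradient_eq_zero {φ : Euc n → ℝ} (hφ : ContDiff ℝ ∞ φ) (hc : HasCompactSupport φ)
    (i : Fin n) : ∫ x, pderiv i φ x = 0 := by
  have hp : Continuous (pderiv i φ) := (BddSmooth.of_hasCompactSupport hφ hc).pderiv i |>.continuous
  have hpc : HasCompactSupport (pderiv i φ) := hc.fderiv_apply (𝕜 := ℝ) (basisVec i)
  have := integral_mul_fderiv_eq_neg_fderiv_mul_of_integrable (𝕜 := ℝ) (μ := (volume : Measure (Euc n)))
    (f := fun _ => (1 : ℝ)) (g := φ) (v := basisVec i) (by simp)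
    (by simp only [one_mul]; exact hp.integrable_of_hasCompactSupport hpc)
    (by simpa using hφ.continuous.integrable_of_hasCompactSupport hc)
    (by simp) (fun x _ => hφ.differentiable (by simp) x)
  simpa [pderiv] using this

lemma hasWeakGradient_one : HasWeakGradient (fun _ : Euc n => (1 : ℝ)) (fun _ => 0) where
  locallyIntegrable := locallyIntegrable_const 1
  locallyIntegrable_grad := locallyIntegrable_const 0
  integral_smul_gradient := fun φ hφ hc => by
    simp only [one_smul, smul_zero, integral_zero, neg_zero]
    have hg : Continuous (gradient φ) :=
      (InnerProductSpace.toDual ℝ (Euc n)).symm.continuous.comp (hφ.continuous_fderiv (by simp))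
    have hgc : HasCompactSupport (gradient φ) :=
      (hc.fderiv (𝕜 := ℝ)).comp_left (g := (InnerProductSpace.toDual ℝ (Euc n)).symm) (map_zero _)
    have hi := hg.integrable_of_hasCompactSupport (μ := volume) hgc
    ext i
    rw [eval_integral_piLp (fun i => (EuclideanSpace.proj i : Euc n →L[ℝ] ℝ).integrable_comp hi)]
    simp only [gradient_apply]
    simpa using integral_gradient_eq_zero hφ hc i

lemma HasWeakGradient.integral_mul_pderiv {f : Euc n → ℝ} {G : Euc n → Euc n}
    (h : HasWeakGradient f G) {φ : Euc n → ℝ} (hφ : ContDiff ℝ ∞ φ) (hc : HasCompactSupport φ)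
    (i : Fin n) : ∫ x, f x * pderiv i φ x = - ∫ x, φ x * G x i := by
  have hg : Continuous (gradient φ) :=
    (InnerProductSpace.toDual ℝ (Euc n)).symm.continuous.comp (hφ.continuous_fderiv (by simp))
  have hgc : HasCompactSupport (gradient φ) :=
    (hc.fderiv (𝕜 := ℝ)).comp_left (g := (InnerProductSpace.toDual ℝ (Euc n)).symm) (map_zero _)
  have h1 : Integrable (fun x => f x • gradient φ x) volume :=
    h.locallyIntegrable.integrable_smul_right_of_hasCompactSupport hg hgc
  have h2 : Integrable (fun x => φ x • G x) volume :=
    h.locallyIntegrable_grad.integrable_smul_left_of_hasCompactSupport hφ.continuous hc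
  have key := congrArg (fun v : Euc n => v i) (h.integral_smul_gradient φ hφ hc)
  simp only [PiLp.neg_apply] at key
  rw [eval_integral_piLp (fun i => (EuclideanSpace.proj i : Euc n →L[ℝ] ℝ).integrable_comp h1),
    eval_integral_piLp (fun i => (EuclideanSpace.proj i : Euc n →L[ℝ] ℝ).integrable_comp h2)] at key
  simpa [gradient_apply] using key

/-- A cutoff function equal to `1` on the ball of radius `k + 1`. -/
noncomputable def cutoff (n k : ℕ) (x : Euc n) : ℝ :=
  (⟨1, 2, one_pos, one_lt_two⟩ : ContDiffBump (0 : Euc n)) (((k : ℝ) + 1)⁻¹ • x)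

lemma contDiff_cutoff (k : ℕ) : ContDiff ℝ ∞ (cutoff n k) :=
  (ContDiffBump.contDiff _).comp (contDiff_const_smul _)

lemma hasCompactSupport_cutoff (k : ℕ) : HasCompactSupport (cutoff n k) :=
  (ContDiffBump.hasCompactSupport (⟨1, 2, one_pos, one_lt_two⟩ : ContDiffBump (0 : Euc n))).comp_smul
    (by positivity)

lemma abs_cutoff_le (k : ℕ) (x : Euc n) : |cutoff n k x| ≤ 1 := by
  rw [cutoff, abs_of_nonneg (ContDiffBump.nonneg _)]
  exact ContDiffBump.le_one _

lemma tendsto_cutoff (x : Euc n) : Tendsto (fun k => cutoff n k x) atTop (𝓝 1) := by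
  have h0 : Tendsto (fun k : ℕ => ((k : ℝ) + 1)⁻¹ • x) atTop (𝓝 ((0 : ℝ) • x)) := by
    refine Tendsto.smul_const ?_ x
    simpa using tendsto_one_div_add_atTop_nhds_zero_nat (𝕜 := ℝ)
  rw [zero_smul] at h0
  let χ : ContDiffBump (0 : Euc n) := ⟨1, 2, one_pos, one_lt_two⟩
  have h1 : Tendsto χ (𝓝 0) (𝓝 (χ 0)) := χ.continuous.continuousAt
  have h2 : χ 0 = 1 := χ.one_of_mem_closedBall (by simp [χ])
  rw [h2] at h1
  exact h1.comp h0

lemma exists_pderiv_cutoff_le (n : ℕ) : ∃ C : ℝ, ∀ (i : Fin n) (k : ℕ) (x : Euc n),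
    |pderiv i (cutoff n k) x| ≤ ((k : ℝ) + 1)⁻¹ * C := by
  let χ : ContDiffBump (0 : Euc n) := ⟨1, 2, one_pos, one_lt_two⟩
  have hχ : BddSmooth χ := BddSmooth.of_hasCompactSupport χ.contDiff χ.hasCompactSupport
  obtain ⟨C, hC0, hC⟩ := hχ.fderiv.bounded
  refine ⟨C, fun i k x => ?_⟩
  have h1 : HasFDerivAt (fun y : Euc n => ((k : ℝ) + 1)⁻¹ • y)
      (((k : ℝ) + 1)⁻¹ • ContinuousLinearMap.id ℝ (Euc n)) x :=
    (((k : ℝ) + 1)⁻¹ • ContinuousLinearMap.id ℝ (Euc n)).hasFDerivAt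
  have h2 := (hχ.differentiable (((k : ℝ) + 1)⁻¹ • x)).hasFDerivAt.comp x h1
  have h3 : pderiv i (cutoff n k) x =
      ((k : ℝ) + 1)⁻¹ * fderiv ℝ χ (((k : ℝ) + 1)⁻¹ • x) (basisVec i) := by
    rw [pderiv]
    have : cutoff n k = χ ∘ fun y : Euc n => ((k : ℝ) + 1)⁻¹ • y := rfl
    rw [this, h2.fderiv]
    simp
  rw [h3, abs_mul, abs_of_pos (by positivity)]
  refine mul_le_mul_of_nonneg_left ?_ (by positivity)
  refine ((fderiv ℝ χ _).le_opNorm _).trans ?_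
  simpa using hC _

lemma pderiv_mul {φ ψ : Euc n → ℝ} {x : Euc n} (hφ : DifferentiableAt ℝ φ x)
    (hψ : DifferentiableAt ℝ ψ x) (i : Fin n) :
    pderiv i (fun y => φ y * ψ y) x = pderiv i φ x * ψ x + φ x * pderiv i ψ x := by
  simp only [pderiv]
  rw [fderiv_fun_mul hφ hψ]
  simp
  ring

/-- Integration by parts against the Gaussian measure for a density with a weak gradient. -/
lemma HasWeakGradient.integral_gauss {f : Euc n → ℝ} {G : Euc n → Euc n}
    (h : HasWeakGradient f G) (hf : Integrable f (gauss n)) (hG : Integrable G (gauss n))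
    (i : Fin n) (hxf : Integrable (fun x => x i * f x) (gauss n)) {w : Euc n → ℝ}
    (hw : BddSmooth w) :
    ∫ x, (pderiv i w x - x i * w x) * f x ∂(gauss n) = - ∫ x, w x * G x i ∂(gauss n) := by
  obtain ⟨Cχ, hCχ⟩ := exists_pderiv_cutoff_le n
  obtain ⟨Cw, hCw0, hCw⟩ := hw.bounded
  obtain ⟨Cp, hCp0, hCp⟩ := (hw.pderiv i).bounded
  have hGi : Integrable (fun x => G x i) (gauss n) :=
    (EuclideanSpace.proj i : Euc n →L[ℝ] ℝ).integrable_comp hG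
  have step : ∀ k : ℕ, ∫ x, (pderiv i w x * cutoff n k x + w x * pderiv i (cutoff n k) x
      - x i * w x * cutoff n k x) * f x ∂(gauss n) = - ∫ x, w x * cutoff n k x * G x i ∂(gauss n) := by
    intro k
    have hd1 : Differentiable ℝ (cutoff n k) := (contDiff_cutoff k).differentiable (by simp)
    have hd2 : Differentiable ℝ (gaussDensity : Euc n → ℝ) :=
      contDiff_gaussDensity.differentiable (by simp)
    -- The test function carries the Gaussian density as a factor: this changes Lebesgue measure
    -- into the Gaussian one, and differentiating the factor creates the term `-x i * w x`.
    have := h.integral_mul_pderiv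
      (φ := fun x => w x * cutoff n k x * gaussDensity x)
      ((hw.contDiff.mul (contDiff_cutoff k)).mul contDiff_gaussDensity)
      (((hasCompactSupport_cutoff k).mul_left).mul_right) i
    rw [GaussianLSI.integral_gauss, GaussianLSI.integral_gauss]
    rw [integral_congr_ae (g := fun x => gaussDensity x * ((pderiv i w x * cutoff n k x
      + w x * pderiv i (cutoff n k) x - x i * w x * cutoff n k x) * f x))] at this
    · rw [this]
      congr 1
      refine integral_congr_ae (Eventually.of_forall fun x => ?_)
      simp only
      ring
    · refine Eventually.of_forall fun x => ?_
      simp only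
      rw [pderiv_mul (φ := fun x => w x * cutoff n k x)
        ((hw.differentiable x).mul (hd1 x)) (hd2 x), pderiv_mul (hw.differentiable x) (hd1 x),
        pderiv_gaussDensity]
      ring
  have hk1 : ∀ k : ℕ, ((k : ℝ) + 1)⁻¹ ≤ 1 := fun k => by
    apply inv_le_one_of_one_le₀
    have := Nat.cast_nonneg (α := ℝ) k
    linarith
  have hk0 : Tendsto (fun k : ℕ => ((k : ℝ) + 1)⁻¹) atTop (𝓝 0) := by
    simpa using tendsto_one_div_add_atTop_nhds_zero_nat (𝕜 := ℝ)
  have hpχ : ∀ x : Euc n, Tendsto (fun k => pderiv i (cutoff n k) x) atTop (𝓝 0) := by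
    intro x
    refine squeeze_zero_norm (fun k => hCχ i k x) ?_
    simpa using hk0.mul_const Cχ
  have hpm : ∀ k, Continuous (pderiv i (cutoff n k)) := fun k =>
    ((BddSmooth.of_hasCompactSupport (contDiff_cutoff k) (hasCompactSupport_cutoff k)).pderiv
      i).continuous
  have hCχ0 : ∀ k x, |pderiv i (cutoff n k) x| ≤ |Cχ| := fun k x =>
    (hCχ i k x).trans ((mul_le_mul_of_nonneg_left (le_abs_self _) (by positivity)).trans
      (mul_le_of_le_one_left (abs_nonneg _) (hk1 k)))
  have hcc : ∀ k, Continuous (cutoff n k) := fun k => (contDiff_cutoff k).continuous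
  have hwc := hw.continuous
  have hwpc := (hw.pderiv i).continuous
  -- Removing the cutoff: its derivatives tend to zero, and the integrability of `f`, `x i * f x`
  -- and `G` supplies the dominating functions.
  have lim1 := tendsto_integral_of_dominated_convergence (μ := gauss n)
    (F := fun k x => (pderiv i w x * cutoff n k x + w x * pderiv i (cutoff n k) x
      - x i * w x * cutoff n k x) * f x)
    (f := fun x => (pderiv i w x - x i * w x) * f x)
    (fun x => (Cp + Cw * |Cχ|) * ‖f x‖ + Cw * ‖x i * f x‖)
    (fun k => AEStronglyMeasurable.mul (Continuous.aestronglyMeasurable (by fun_prop)) hf.1)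
    ((hf.norm.const_mul _).add (hxf.norm.const_mul _))
    (fun k => Eventually.of_forall fun x => ?_)
    (Eventually.of_forall fun x => ?_)
  · have lim2 := tendsto_integral_of_dominated_convergence (μ := gauss n)
      (F := fun k x => w x * cutoff n k x * G x i)
      (f := fun x => w x * G x i)
      (fun x => Cw * ‖G x i‖)
      (fun k => AEStronglyMeasurable.mul (Continuous.aestronglyMeasurable (by fun_prop)) hGi.1)
      (hGi.norm.const_mul _)
      (fun k => Eventually.of_forall fun x => ?_)
      (Eventually.of_forall fun x => ?_)
    · simp only [step] at lim1
      exact tendsto_nhds_unique lim1 lim2.neg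
    · rw [norm_mul, norm_mul]
      refine mul_le_mul_of_nonneg_right ?_ (norm_nonneg _)
      exact (mul_le_of_le_one_right (norm_nonneg _) (abs_cutoff_le k x)).trans (hCw x)
    · have := ((tendsto_cutoff x).const_mul (w x)).mul_const (G x i)
      simpa using this
  · have e1 : (pderiv i w x * cutoff n k x + w x * pderiv i (cutoff n k) x
      - x i * w x * cutoff n k x) * f x = pderiv i w x * cutoff n k x * f x
      + w x * pderiv i (cutoff n k) x * f x - w x * cutoff n k x * (x i * f x) := by ring
    rw [e1]
    have b1 : ‖pderiv i w x * cutoff n k x * f x‖ ≤ Cp * ‖f x‖ := by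
      rw [norm_mul, norm_mul]
      exact mul_le_mul_of_nonneg_right
        ((mul_le_of_le_one_right (norm_nonneg _) (abs_cutoff_le k x)).trans (hCp x)) (norm_nonneg _)
    have b2 : ‖w x * pderiv i (cutoff n k) x * f x‖ ≤ Cw * |Cχ| * ‖f x‖ := by
      rw [norm_mul, norm_mul]
      exact mul_le_mul_of_nonneg_right
        (mul_le_mul (hCw x) (hCχ0 k x) (norm_nonneg _) hCw0) (norm_nonneg _)
    have b3 : ‖w x * cutoff n k x * (x i * f x)‖ ≤ Cw * ‖x i * f x‖ := by
      rw [norm_mul, norm_mul (w x)]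
      exact mul_le_mul_of_nonneg_right
        ((mul_le_of_le_one_right (norm_nonneg _) (abs_cutoff_le k x)).trans (hCw x)) (norm_nonneg _)
    refine (norm_sub_le _ _).trans ?_
    refine (add_le_add ((norm_add_le _ _).trans (add_le_add b1 b2)) b3).trans (le_of_eq ?_)
    ring
  · have := ((((tendsto_cutoff x).const_mul (pderiv i w x)).add ((hpχ x).const_mul (w x))).sub
      ((tendsto_cutoff x).const_mul (x i * w x))).mul_const (f x)
    simpa using this

lemma integrable_id_gauss : Integrable (fun x : Euc n => x) (gauss n) := IsGaussian.integrable_id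

lemma integrable_coord_gauss (i : Fin n) : Integrable (fun x : Euc n => x i) (gauss n) :=
  (EuclideanSpace.proj i : Euc n →L[ℝ] ℝ).integrable_comp integrable_id_gauss

/-- Gaussian integration by parts. -/
lemma integral_coord_mul_gauss {w : Euc n → ℝ} (hw : BddSmooth w) (i : Fin n) :
    ∫ x, x i * w x ∂(gauss n) = ∫ x, pderiv i w x ∂(gauss n) := by
  obtain ⟨C, -, hC⟩ := hw.bounded
  have h := hasWeakGradient_one.integral_gauss (integrable_const 1) (integrable_zero _ _ _) i
    (by simpa using integrable_coord_gauss i) hw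
  simp only [mul_one, PiLp.zero_apply, mul_zero, integral_zero, neg_zero] at h
  rw [integral_sub (hw.pderiv i).integrable
    ((integrable_coord_gauss i).mul_bdd hw.continuous.aestronglyMeasurable
      (Eventually.of_forall hC))] at h
  linarith

/-! ### A reverse Poincaré inequality -/

lemma bdd_iteratedFDeriv_comp_affine (b : ℝ) (y : Euc n) (k : ℕ) :
    ∀ {G : Type} [NormedAddCommGroup G] [NormedSpace ℝ G] {F : Euc n → G}, BddSmooth F →
    ∃ C : ℝ, ∀ z, ‖iteratedFDeriv ℝ k (fun z => F (y + b • z)) z‖ ≤ C := by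
  induction k with
  | zero =>
    intro G _ _ F hF
    obtain ⟨C, hC0, hC⟩ := hF.bounded
    exact ⟨C, fun x => by rw [norm_iteratedFDeriv_zero]; exact hC _⟩
  | succ k ih =>
    intro G _ _ F hF
    have hd : ∀ z, HasFDerivAt (fun z => F (y + b • z)) (b • fderiv ℝ F (y + b • z)) z := by
      intro z
      have h1 : HasFDerivAt (fun z : Euc n => y + b • z) (b • ContinuousLinearMap.id ℝ (Euc n)) z :=
        (b • ContinuousLinearMap.id ℝ (Euc n)).hasFDerivAt.const_add y
      have h2 := (hF.differentiable (y + b • z)).hasFDerivAt.comp z h1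
      convert! h2 using 1
      ext v
      simp
    have : fderiv ℝ (fun z => F (y + b • z)) = b • fun z => fderiv ℝ F (y + b • z) :=
      funext fun z => (hd z).fderiv
    obtain ⟨C, hC⟩ := ih hF.fderiv
    refine ⟨‖b‖ * C, fun x => ?_⟩
    have hcd : ContDiff ℝ ∞ fun z => fderiv ℝ F (y + b • z) :=
      hF.fderiv.contDiff.comp (contDiff_const.add (contDiff_const_smul b))
    rw [← norm_iteratedFDeriv_fderiv, this, iteratedFDeriv_const_smul_apply
      (hcd.contDiffAt.of_le (by exact_mod_cast le_top)), norm_smul]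
    exact mul_le_mul_of_nonneg_left (hC x) (norm_nonneg b)

lemma BddSmooth.comp_affine {G : Type} [NormedAddCommGroup G] [NormedSpace ℝ G] {F : Euc n → G}
    (hF : BddSmooth F) (y : Euc n) (b : ℝ) : BddSmooth (fun z => F (y + b • z)) :=
  ⟨hF.contDiff.comp (contDiff_const.add (contDiff_const_smul b)),
    fun k => bdd_iteratedFDeriv_comp_affine b y k hF⟩

lemma pderiv_comp_affine {φ : Euc n → ℝ} (hφ : BddSmooth φ) (y : Euc n) (b : ℝ) (i : Fin n)
    (z : Euc n) : pderiv i (fun z => φ (y + b • z)) z = b * pderiv i φ (y + b • z) := by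
  have h1 : HasFDerivAt (fun z : Euc n => y + b • z) (b • ContinuousLinearMap.id ℝ (Euc n)) z :=
    (b • ContinuousLinearMap.id ℝ (Euc n)).hasFDerivAt.const_add y
  have h2 := (hφ.differentiable (y + b • z)).hasFDerivAt.comp z h1
  have h3 : (fun z => φ (y + b • z)) = φ ∘ fun z => y + b • z := rfl
  rw [pderiv, h3, h2.fderiv]
  simp [pderiv]

/-- Gaussian integration by parts under an affine change of variables. -/
lemma integral_coord_mul_comp_affine {φ : Euc n → ℝ} (hφ : BddSmooth φ) (y : Euc n) (b : ℝ)
    (i : Fin n) : ∫ z, z i * φ (y + b • z) ∂(gauss n) =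
      b * ∫ z, pderiv i φ (y + b • z) ∂(gauss n) := by
  rw [integral_coord_mul_gauss (hφ.comp_affine y b) i, ← integral_const_mul]
  simp only [pderiv_comp_affine hφ]

lemma integrable_coord_mul {φ : Euc n → ℝ} (hφ : BddSmooth φ) (i : Fin n)
    {μ : Measure (Euc n)} (hμ : Integrable (fun x : Euc n => x) μ) :
    Integrable (fun x => x i * φ x) μ := by
  obtain ⟨C, -, hC⟩ := hφ.bounded
  exact ((EuclideanSpace.proj i : Euc n →L[ℝ] ℝ).integrable_comp hμ).mul_bdd
    hφ.continuous.aestronglyMeasurable (Eventually.of_forall hC)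

lemma BddSmooth.integrable_sq {φ : Euc n → ℝ} (hφ : BddSmooth φ) {α : Type*} [MeasurableSpace α]
    {μ : Measure α} [IsFiniteMeasure μ] {g : α → Euc n} (hg : Measurable g) :
    Integrable (fun z => φ (g z) ^ 2) μ := by
  obtain ⟨C, hC0, hC⟩ := hφ.bounded
  refine Integrable.of_bound
    ((hφ.continuous.stronglyMeasurable.comp_measurable hg).pow 2).aestronglyMeasurable
    (C ^ 2) (Eventually.of_forall fun z => ?_)
  rw [norm_pow]
  exact pow_le_pow_left₀ (norm_nonneg _) (hC _) 2

/-- Bessel's inequality for the constant and linear functions in `L²` of the Gaussian measure. -/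
lemma sq_integral_add_sum_le {φ : Euc n → ℝ} (hφ : BddSmooth φ) :
    (∫ x, φ x ∂(gauss n)) ^ 2 + ∑ i, (∫ x, x i * φ x ∂(gauss n)) ^ 2 ≤
      ∫ x, φ x ^ 2 ∂(gauss n) := by
  set p := ∫ x, φ x ∂(gauss n) with hp
  -- `p + L` is the orthogonal projection of `φ` onto the affine functions; under the Gaussian
  -- measure `L` has mean zero and variance `‖m‖²`.
  let m : Euc n := WithLp.toLp 2 fun i => ∫ x, x i * φ x ∂(gauss n)
  have hm : ∀ i, m i = ∫ x, x i * φ x ∂(gauss n) := fun i => rfl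
  let L : StrongDual ℝ (Euc n) := innerSL ℝ m
  have hL : ∀ x, L x = ∑ i, m i * x i := fun x => by
    simp [L, innerSL_apply_apply, PiLp.inner_apply, mul_comm]
  have hL2 : MemLp L 2 (gauss n) := by
    have := L.comp_memLp' (IsGaussian.memLp_two_id (μ := gauss n))
    exact this
  have hLint : Integrable L (gauss n) := L.integrable_comp integrable_id_gauss
  have hLmean : ∫ x, L x ∂(gauss n) = 0 := integral_strongDual_stdGaussian L
  have hLsq : ∫ x, L x ^ 2 ∂(gauss n) = ∑ i, m i ^ 2 := by
    have h1 := variance_dual_stdGaussian (E := Euc n) L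
    rw [variance_eq_integral hL2.1.aemeasurable] at h1
    change ∫ x, (L x - ∫ y, L y ∂(gauss n)) ^ 2 ∂(gauss n) = _ at h1
    simp only [hLmean, sub_zero] at h1
    rw [h1, ← EuclideanSpace.real_norm_sq_eq]
    simp [L]
  have hLφ : ∫ x, L x * φ x ∂(gauss n) = ∑ i, m i ^ 2 := by
    have : ∀ x, L x * φ x = ∑ i, m i * (x i * φ x) := fun x => by
      rw [hL, Finset.sum_mul]
      exact Finset.sum_congr rfl fun i _ => by ring
    simp only [this]
    rw [integral_finsetSum _ fun i _ => (integrable_coord_mul hφ i integrable_id_gauss).const_mul _]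
    refine Finset.sum_congr rfl fun i _ => ?_
    rw [integral_const_mul, ← hm, sq]
  have hLφi : Integrable (fun x => L x * φ x) (gauss n) := by
    obtain ⟨C, -, hC⟩ := hφ.bounded
    exact hLint.mul_bdd hφ.continuous.aestronglyMeasurable (Eventually.of_forall hC)
  have hφ2 : Integrable (fun x => φ x ^ 2) (gauss n) := hφ.integrable_sq measurable_id
  have hφi : Integrable φ (gauss n) := hφ.integrable
  have h0 : 0 ≤ ∫ x, (φ x - p - L x) ^ 2 ∂(gauss n) := integral_nonneg fun x => sq_nonneg _
  have e : ∀ x, (φ x - p - L x) ^ 2 =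
      φ x ^ 2 + L x ^ 2 - 2 * (L x * φ x) - 2 * p * φ x + 2 * p * L x + p ^ 2 := fun x => by ring
  simp only [e] at h0
  have i2 := hφ2.add hL2.integrable_sq
  have i3 := i2.sub (hLφi.const_mul 2)
  have i4 := i3.sub (hφi.const_mul (2 * p))
  have i5 := i4.add (hLint.const_mul (2 * p))
  rw [integral_add (f := fun x => φ x ^ 2 + L x ^ 2 - 2 * (L x * φ x) - 2 * p * φ x + 2 * p * L x)
      i5 (integrable_const _),
    integral_add (f := fun x => φ x ^ 2 + L x ^ 2 - 2 * (L x * φ x) - 2 * p * φ x)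
      i4 (hLint.const_mul _),
    integral_sub (f := fun x => φ x ^ 2 + L x ^ 2 - 2 * (L x * φ x)) i3 (hφi.const_mul _),
    integral_sub (f := fun x => φ x ^ 2 + L x ^ 2) i2 (hLφi.const_mul _),
    integral_add hφ2 hL2.integrable_sq, integral_const_mul, integral_const_mul, integral_const_mul,
    hLsq, hLφ, hLmean, ← hp, integral_const] at h0
  simp only [probReal_univ, smul_eq_mul] at h0
  simp only [← hm]
  nlinarith

/-- The reverse Poincaré inequality for Gaussian averages. -/
lemma sq_gAvg_add_le {u : Euc n → ℝ} (hu : BddSmooth u) (a b : ℝ) (x : Euc n) :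
    gAvg a b u x ^ 2 + b ^ 2 * ∑ j, gAvg a b (pderiv j u) x ^ 2 ≤
      gAvg a b (fun y => u y ^ 2) x := by
  have h := sq_integral_add_sum_le (hu.comp_affine (a • x) b)
  -- The linear coefficients become `b` times the averages of the partial derivatives.
  simp only [integral_coord_mul_comp_affine hu, mul_pow] at h
  rw [← Finset.mul_sum] at h
  exact h

lemma abs_gAvg_le {φ : Euc n → ℝ} {C : ℝ} (hC : ∀ x, ‖φ x‖ ≤ C) (a b : ℝ) (x : Euc n) :
    |gAvg a b φ x| ≤ C := by
  have := norm_integral_le_of_norm_le_const (μ := gauss n) (f := fun z => φ (a • x + b • z))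
    (C := C) (Eventually.of_forall fun z => hC _)
  simpa [gAvg] using this

lemma BddSmooth.integrable_gAvg_sq {u : Euc n → ℝ} (hu : BddSmooth u) (a b : ℝ)
    {ν : Measure (Euc n)} [IsFiniteMeasure ν] :
    Integrable (fun x => GaussianLSI.gAvg a b (fun y => u y ^ 2) x) ν := by
  obtain ⟨C, hC0, hC⟩ := hu.bounded
  refine Integrable.of_bound (C := C ^ 2) ?_ (Eventually.of_forall fun x => ?_)
  · have hcont : Continuous fun p : Euc n × Euc n => u (a • p.1 + b • p.2) ^ 2 :=
      (hu.continuous.comp (by fun_prop)).pow 2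
    exact (hcont.stronglyMeasurable.integral_prod_right (ν := gauss n)).aestronglyMeasurable
  · exact abs_gAvg_le (φ := fun y => u y ^ 2) (fun y => by
      rw [norm_pow]; exact pow_le_pow_left₀ (norm_nonneg _) (hC _) 2) a b x

/-! ### The Poincaré inequality for bounded smooth functions -/

lemma MemPoincareClass.real {l : ℝ} {ν : Measure (Euc n)} (h : MemPoincareClass l ν)
    {g : Euc n → ℝ} (hg : BddSmooth g) :
    -- The class inequality is applied to `g` minus its mean; boundedness makes all the integrals
    -- finite, hence real.
    l * (∫ x, g x ^ 2 ∂ν - (∫ x, g x ∂ν) ^ 2) ≤ ∑ j, ∫ x, pderiv j g x ^ 2 ∂ν := by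
  have := h.isProbabilityMeasure
  set m := ∫ x, g x ∂ν with hm
  have hg' : BddSmooth (fun x => -m + g x) := hg.const_add (-m)
  have hp : ∀ j x, pderiv j (fun x => -m + g x) x = pderiv j g x := fun j x => by
    rw [pderiv, fderiv_const_add]; rfl
  have h1 := h.poincare _ hg'.contDiff hg'.integrable (by
    rw [integral_add (integrable_const _) hg.integrable, integral_const, ← hm]; simp)
  have i1 : Integrable (fun x => (-m + g x) ^ 2) ν := hg'.integrable_sq measurable_id
  have i2 : ∀ j, Integrable (fun x => pderiv j g x ^ 2) ν := fun j =>
    (hg.pderiv j).integrable_sq measurable_id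
  have i3 : Integrable (fun x => ∑ j, pderiv j g x ^ 2) ν := integrable_finsetSum _ fun j _ => i2 j
  have e1 : ∫⁻ x, ‖-m + g x‖ₑ ^ 2 ∂ν = ENNReal.ofReal (∫ x, (-m + g x) ^ 2 ∂ν) := by
    rw [ofReal_integral_eq_lintegral_ofReal i1 (Eventually.of_forall fun x => sq_nonneg _)]
    refine lintegral_congr fun x => ?_
    rw [← ofReal_norm, ← ENNReal.ofReal_pow (norm_nonneg _), Real.norm_eq_abs, sq_abs]
  have e2 : ∫⁻ x, ‖gradient (fun x => -m + g x) x‖ₑ ^ 2 ∂ν =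
      ENNReal.ofReal (∫ x, ∑ j, pderiv j g x ^ 2 ∂ν) := by
    rw [ofReal_integral_eq_lintegral_ofReal i3
      (Eventually.of_forall fun x => Finset.sum_nonneg fun j _ => sq_nonneg _)]
    refine lintegral_congr fun x => ?_
    rw [← ofReal_norm, ← ENNReal.ofReal_pow (norm_nonneg _), norm_gradient_sq]
    simp only [hp]
  rw [e1, e2, ← ENNReal.ofReal_mul h.pos.le, ENNReal.ofReal_le_ofReal_iff
    (integral_nonneg fun x => Finset.sum_nonneg fun j _ => sq_nonneg _)] at h1
  rw [integral_finsetSum _ fun j _ => i2 j] at h1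
  refine le_trans (le_of_eq ?_) h1
  congr 1
  have e3 : ∀ x, (-m + g x) ^ 2 = g x ^ 2 - 2 * m * g x + m ^ 2 := fun x => by ring
  have ig2 : Integrable (fun x => g x ^ 2) ν := hg.integrable_sq measurable_id
  simp only [e3]
  rw [integral_add (f := fun x => g x ^ 2 - 2 * m * g x)
    (ig2.sub (hg.integrable.const_mul _)) (integrable_const _),
    integral_sub ig2 (hg.integrable.const_mul _), integral_const_mul, ← hm, integral_const]
  simp only [probReal_univ, smul_eq_mul]
  ring

/-! ### The contribution of one coordinate -/

section density

variable {ν : Measure (Euc n)} {f : Euc n → ℝ}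

lemma integral_density (hf_meas : Measurable f) (hf_nonneg : ∀ x, 0 ≤ f x)
    (hν : ν = (gauss n).withDensity (fun x => ENNReal.ofReal (f x))) (φ : Euc n → ℝ) :
    ∫ x, φ x ∂ν = ∫ x, φ x * f x ∂(gauss n) := by
  rw [hν, integral_withDensity_eq_integral_toReal_smul hf_meas.ennreal_ofReal
    (Eventually.of_forall fun x => ENNReal.ofReal_lt_top)]
  simp only [ENNReal.toReal_ofReal (hf_nonneg _), smul_eq_mul, mul_comm]

lemma integrable_density_iff (hf_meas : Measurable f) (hf_nonneg : ∀ x, 0 ≤ f x)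
    (hν : ν = (gauss n).withDensity (fun x => ENNReal.ofReal (f x))) (φ : Euc n → ℝ) :
    Integrable φ ν ↔ Integrable (fun x => φ x * f x) (gauss n) := by
  rw [hν, integrable_withDensity_iff_integrable_smul' hf_meas.ennreal_ofReal
    (Eventually.of_forall fun x => ENNReal.ofReal_lt_top)]
  simp only [ENNReal.toReal_ofReal (hf_nonneg _), smul_eq_mul, mul_comm]

/-- The only place where the Poincaré inequality of `ν` enters. With `w` the average of `u` and `m`
its `ν`-mean, the average of `u²` has `ν`-integral at least `a` times the variance of `w`. On the
other side, `2 ∫ w g = 2 ∫ (w - m) g`, which is at most `a` times that variance plus `(∫ g² / f) /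
a`. It is later used with `c = cos θ`, `s = sin θ`, `g` a coordinate of `G` and `u` a partial
derivative of `F`. -/
lemma coordinate_bound {l : ℝ} (hf_meas : Measurable f) (hf_nonneg : ∀ x, 0 ≤ f x)
    (hν : ν = (gauss n).withDensity (fun x => ENNReal.ofReal (f x)))
    (hclass : MemPoincareClass l ν) {g : Euc n → ℝ} (hg : Integrable g (gauss n))
    (hg0 : ∫ x, g x ∂(gauss n) = 0) (hgf : ∀ᵐ x ∂(gauss n), f x = 0 → g x = 0)
    (hg2 : Integrable (fun x => g x ^ 2 / f x) (gauss n)) {u : Euc n → ℝ} (hu : BddSmooth u)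
    {c s : ℝ} (hc : 0 < c) :
    2 * ∫ x, gAvg (c ^ 2) (c * s) u x * g x ∂(gauss n)
      - ∫ x, gAvg (c ^ 2) (c * s) (fun y => u y ^ 2) x ∂ν ≤
      (∫ x, g x ^ 2 / f x ∂(gauss n)) / (1 + l * s ^ 2 / c ^ 2) := by
  have := hclass.isProbabilityMeasure
  have hl := hclass.pos
  set a := 1 + l * s ^ 2 / c ^ 2 with ha
  have hapos : 0 < a := by positivity
  set w := gAvg (c ^ 2) (c * s) u with hw
  have hwb : BddSmooth w := hu.gAvg _ _
  set m := ∫ x, w x ∂ν with hm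
  have iw2 : Integrable (fun x => w x ^ 2) ν := hwb.integrable_sq measurable_id
  have iwg : Integrable (fun x => w x * g x) (gauss n) := by
    obtain ⟨C, -, hC⟩ := hwb.bounded
    exact hg.bdd_mul hwb.continuous.aestronglyMeasurable (Eventually.of_forall hC)
  have iwm2 : Integrable (fun x => (w x - m) ^ 2) ν := by
    have := (hwb.const_add (-m)).integrable_sq (μ := ν) measurable_id
    refine this.congr (Eventually.of_forall fun x => ?_)
    simp only [id]; ring
  have hvar : ∫ x, (w x - m) ^ 2 ∂ν = ∫ x, w x ^ 2 ∂ν - m ^ 2 := by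
    have e3 : ∀ x, (w x - m) ^ 2 = w x ^ 2 - 2 * m * w x + m ^ 2 := fun x => by ring
    simp only [e3]
    rw [integral_add (f := fun x => w x ^ 2 - 2 * m * w x)
      (iw2.sub (hwb.integrable.const_mul _)) (integrable_const _),
      integral_sub iw2 (hwb.integrable.const_mul _), integral_const_mul, ← hm, integral_const]
    simp only [probReal_univ, smul_eq_mul]
    ring
  -- the reverse Poincaré inequality and the Poincaré inequality of the measure
  have hpw : ∀ j x, pderiv j w x = c ^ 2 * gAvg (c ^ 2) (c * s) (pderiv j u) x :=
    fun j x => pderiv_gAvg hu _ _ j x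
  have h1 : ∀ x, w x ^ 2 + (s ^ 2 / c ^ 2) * ∑ j, pderiv j w x ^ 2 ≤
      gAvg (c ^ 2) (c * s) (fun y => u y ^ 2) x := by
    intro x
    refine le_trans (le_of_eq ?_) (sq_gAvg_add_le hu (c ^ 2) (c * s) x)
    simp only [hpw, mul_pow, ← Finset.mul_sum]
    rw [← hw]
    field_simp
  have ipw : ∀ j, Integrable (fun x => pderiv j w x ^ 2) ν := fun j =>
    (hwb.pderiv j).integrable_sq measurable_id
  have ipws : Integrable (fun x => ∑ j, pderiv j w x ^ 2) ν :=
    integrable_finsetSum _ fun j _ => ipw j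
  have iA : Integrable (fun x => gAvg (c ^ 2) (c * s) (fun y => u y ^ 2) x) ν :=
    hu.integrable_gAvg_sq _ _
  have h2 := integral_mono (iw2.add (ipws.const_mul (s ^ 2 / c ^ 2))) iA h1
  have h2' : ∫ x, w x ^ 2 ∂ν + (s ^ 2 / c ^ 2) * ∑ j, ∫ x, pderiv j w x ^ 2 ∂ν ≤
      ∫ x, gAvg (c ^ 2) (c * s) (fun y => u y ^ 2) x ∂ν := by
    rw [← integral_finsetSum _ fun j _ => ipw j, ← integral_const_mul,
      ← integral_add iw2 (ipws.const_mul _)]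
    exact h2
  have h3 := mul_le_mul_of_nonneg_left (hclass.real hwb) (show 0 ≤ s ^ 2 / c ^ 2 by positivity)
  -- the weighted arithmetic-geometric mean inequality
  have h4 : ∫ x, 2 * ((w x - m) * g x) ∂(gauss n) ≤
      ∫ x, (a * ((w x - m) ^ 2 * f x) + (g x ^ 2 / f x) / a) ∂(gauss n) := by
    refine integral_mono_ae ?_ ?_ ?_
    · refine Integrable.const_mul ?_ 2
      refine (iwg.sub (hg.const_mul m)).congr (Eventually.of_forall fun x => ?_)
      simp only [Pi.sub_apply]; ring
    · exact (((integrable_density_iff hf_meas hf_nonneg hν _).1 iwm2).const_mul a).add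
        (hg2.div_const a)
    · filter_upwards [hgf] with x hx
      -- Where `f` vanishes so does `g`, and the convention `0 / 0 = 0` makes both sides zero.
      rcases (hf_nonneg x).eq_or_lt with h0 | hpos
      · rw [hx h0.symm, ← h0]; simp
      · have e : a * ((w x - m) ^ 2 * f x) + (g x ^ 2 / f x) / a - 2 * ((w x - m) * g x) =
            (a * f x * (w x - m) - g x) ^ 2 / (a * f x) := by
          field_simp
          ring
        have : 0 ≤ (a * f x * (w x - m) - g x) ^ 2 / (a * f x) := by positivity
        linarith
  have h5 : ∫ x, 2 * ((w x - m) * g x) ∂(gauss n) = 2 * ∫ x, w x * g x ∂(gauss n) := by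
    rw [integral_const_mul]
    congr 1
    have : ∀ x, (w x - m) * g x = w x * g x - m * g x := fun x => by ring
    simp only [this]
    rw [integral_sub iwg (hg.const_mul m), integral_const_mul, hg0]
    ring
  rw [h5, integral_add (((integrable_density_iff hf_meas hf_nonneg hν _).1 iwm2).const_mul a)
    (hg2.div_const a), integral_const_mul, ← integral_density hf_meas hf_nonneg hν, hvar,
    integral_div] at h4
  -- The square of the mean is discarded here.
  have h6 : a * (∫ x, w x ^ 2 ∂ν - m ^ 2) ≤
      ∫ x, w x ^ 2 ∂ν + s ^ 2 / c ^ 2 * (l * (∫ x, w x ^ 2 ∂ν - m ^ 2)) := by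
    rw [ha]
    have e : s ^ 2 / c ^ 2 * (l * (∫ x, w x ^ 2 ∂ν - m ^ 2)) =
      l * s ^ 2 / c ^ 2 * (∫ x, w x ^ 2 ∂ν - m ^ 2) := by ring
    rw [e]
    nlinarith [sq_nonneg m]
  linarith

end density

/-! ### Centered measures of finite Fisher information in the Poincaré class -/

/-- `ν = f γ` is a centered measure in `P(l)` and `G` is a weak gradient of `f`
with `∫ |G|² / f dγ < ∞`. -/
structure HasFiniteInfo (l : ℝ) (ν : Measure (Euc n)) (f : Euc n → ℝ) (G : Euc n → Euc n) :
    Prop where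
  measurable : Measurable f
  nonneg : ∀ x, 0 ≤ f x
  eq_withDensity : ν = (gauss n).withDensity (fun x => ENNReal.ofReal (f x))
  mem : MemPoincareClass l ν
  centered : IsCentered ν
  weak : HasWeakGradient f G
  integrable_grad : Integrable G (gauss n)
  grad_eq_zero : ∀ᵐ x ∂(gauss n), f x = 0 → G x = 0
  integrable_info : Integrable (fun x => ‖G x‖ ^ 2 / f x) (gauss n)

namespace HasFiniteInfo

variable {l : ℝ} {ν : Measure (Euc n)} {f : Euc n → ℝ} {G : Euc n → Euc n}

lemma isProbabilityMeasure (H : HasFiniteInfo l ν f G) : IsProbabilityMeasure ν :=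
  H.mem.isProbabilityMeasure

lemma integral_eq (H : HasFiniteInfo l ν f G) (φ : Euc n → ℝ) :
    ∫ x, φ x ∂ν = ∫ x, φ x * f x ∂(gauss n) :=
  integral_density H.measurable H.nonneg H.eq_withDensity φ

lemma integrable_iff (H : HasFiniteInfo l ν f G) (φ : Euc n → ℝ) :
    Integrable φ ν ↔ Integrable (fun x => φ x * f x) (gauss n) :=
  integrable_density_iff H.measurable H.nonneg H.eq_withDensity φ

lemma integrable (H : HasFiniteInfo l ν f G) : Integrable f (gauss n) := by
  have := H.isProbabilityMeasure
  simpa using (H.integrable_iff (fun _ => 1)).1 (integrable_const 1)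

lemma integral_eq_one (H : HasFiniteInfo l ν f G) : ∫ x, f x ∂(gauss n) = 1 := by
  have := H.isProbabilityMeasure
  simpa using (H.integral_eq (fun _ => 1)).symm

lemma integral_by_parts (H : HasFiniteInfo l ν f G) {w : Euc n → ℝ} (hw : BddSmooth w)
    (i : Fin n) :
    ∫ x, (pderiv i w x - x i * w x) ∂ν = - ∫ x, w x * G x i ∂(gauss n) := by
  rw [H.integral_eq]
  exact H.weak.integral_gauss H.integrable H.integrable_grad i
    ((H.integrable_iff _).1 ((EuclideanSpace.proj i : Euc n →L[ℝ] ℝ).integrable_comp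
      H.centered.integrable)) hw

/-- Testing with the constant `1` identifies this integral with a coordinate of the barycenter of
`ν`, which is zero by centering. -/
lemma integral_grad (H : HasFiniteInfo l ν f G) (i : Fin n) : ∫ x, G x i ∂(gauss n) = 0 := by
  have h1 : BddSmooth (fun _ : Euc n => (1 : ℝ)) := by
    have h0 : BddSmooth (fun _ : Euc n => (0 : ℝ)) :=
      BddSmooth.of_hasCompactSupport contDiff_const HasCompactSupport.zero
    simpa using h0.const_add 1
  have h := H.integral_by_parts h1 i
  have hp : ∀ x : Euc n, pderiv i (fun _ => (1 : ℝ)) x = 0 := fun x => by simp [pderiv]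
  simp only [hp, zero_sub, mul_one, one_mul, integral_neg] at h
  have hc := congrArg (fun v : Euc n => v i) H.centered.integral_eq_zero
  simp only [PiLp.zero_apply] at hc
  rw [eval_integral_piLp (fun i => (EuclideanSpace.proj i : Euc n →L[ℝ] ℝ).integrable_comp
    H.centered.integrable)] at hc
  linarith

lemma integrable_info_coord (H : HasFiniteInfo l ν f G) (i : Fin n) :
    Integrable (fun x => G x i ^ 2 / f x) (gauss n) := by
  have hGi : Integrable (fun x => G x i) (gauss n) :=
    (EuclideanSpace.proj i : Euc n →L[ℝ] ℝ).integrable_comp H.integrable_grad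
  refine H.integrable_info.mono
    ((hGi.1.aemeasurable.pow_const 2).div H.measurable.aemeasurable).aestronglyMeasurable
    (Eventually.of_forall fun x => ?_)
  have hf := H.nonneg x
  rw [Real.norm_of_nonneg (by positivity), Real.norm_of_nonneg (by positivity)]
  refine div_le_div_of_nonneg_right ?_ hf
  rw [← sq_abs]
  exact pow_le_pow_left₀ (abs_nonneg _) (PiLp.norm_apply_le (G x) i) 2

lemma sum_info (H : HasFiniteInfo l ν f G) :
    ∑ i, ∫ x, G x i ^ 2 / f x ∂(gauss n) = ∫ x, ‖G x‖ ^ 2 / f x ∂(gauss n) := by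
  rw [← integral_finsetSum _ fun i _ => H.integrable_info_coord i]
  refine integral_congr_ae (Eventually.of_forall fun x => ?_)
  simp only
  rw [EuclideanSpace.real_norm_sq_eq, Finset.sum_div]

end HasFiniteInfo

/-! ### The interpolation -/

/-- The interpolating point `cos² θ x + cos θ sin θ z`. -/
noncomputable def curve (x z : Euc n) (θ : ℝ) : Euc n :=
  Real.cos θ ^ 2 • x + (Real.cos θ * Real.sin θ) • z

/-- The derivative of `curve`. -/
noncomputable def curveDeriv (x z : Euc n) (θ : ℝ) : Euc n :=
  (-2 * Real.cos θ * Real.sin θ) • x + (Real.cos θ ^ 2 - Real.sin θ ^ 2) • z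

lemma hasDerivAt_curve (x z : Euc n) (θ : ℝ) : HasDerivAt (curve x z) (curveDeriv x z θ) θ := by
  have hc := Real.hasDerivAt_cos θ
  have hs := Real.hasDerivAt_sin θ
  have h1 := ((hc.pow 2).smul_const x).add ((hc.mul hs).smul_const z)
  convert! h1 using 1
  simp only [curveDeriv]
  congr 2
  · push_cast; ring
  · ring

lemma norm_curveDeriv_le (x z : Euc n) (θ : ℝ) : ‖curveDeriv x z θ‖ ≤ ‖x‖ + ‖z‖ := by
  have h := Real.sin_sq_add_cos_sq θ
  refine (norm_add_le _ _).trans ?_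
  rw [norm_smul, norm_smul, Real.norm_eq_abs, Real.norm_eq_abs]
  refine add_le_add (mul_le_of_le_one_left (norm_nonneg _) ?_)
    (mul_le_of_le_one_left (norm_nonneg _) ?_)
  · rw [abs_le]; constructor <;>
    nlinarith [sq_nonneg (Real.cos θ - Real.sin θ), sq_nonneg (Real.cos θ + Real.sin θ)]
  · rw [abs_le]; constructor <;> nlinarith [sq_nonneg (Real.cos θ), sq_nonneg (Real.sin θ)]

lemma continuous_curve (θ : ℝ) : Continuous fun p : Euc n × Euc n => curve p.1 p.2 θ := by
  unfold curve; fun_prop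

lemma continuous_curveDeriv (θ : ℝ) :
    Continuous fun p : Euc n × Euc n => curveDeriv p.1 p.2 θ := by
  unfold curveDeriv; fun_prop

/-- Varying the base point gives the transport term. Varying the width `sin θ` gives a term linear
in the Gaussian variable, which integration by parts turns into second derivatives, as in the heat
equation. -/
lemma hasDerivAt_gAvg_curve {h : Euc n → ℝ} (hh : BddSmooth h) (x z : Euc n) (θ : ℝ) :
    HasDerivAt (fun θ => gAvg 1 (Real.sin θ) h (curve x z θ))
      (∑ i, (curveDeriv x z θ i * gAvg 1 (Real.sin θ) (pderiv i h) (curve x z θ) +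
        Real.cos θ * Real.sin θ * gAvg 1 (Real.sin θ) (pderiv i (pderiv i h)) (curve x z θ))) θ := by
  obtain ⟨C, hC0, hC⟩ := hh.fderiv.bounded
  have key := hasDerivAt_integral_of_dominated_loc_of_deriv_le (μ := gauss n) (x₀ := θ)
    (F := fun θ z' => h ((1 : ℝ) • curve x z θ + Real.sin θ • z'))
    (F' := fun θ z' => fderiv ℝ h ((1 : ℝ) • curve x z θ + Real.sin θ • z')
      (curveDeriv x z θ + Real.cos θ • z'))
    (bound := fun z' => C * (‖x‖ + ‖z‖ + ‖z'‖)) (s := Set.univ) univ_mem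
    (Eventually.of_forall fun t => (hh.integrable_comp (by fun_prop)).aestronglyMeasurable)
    (hh.integrable_comp (by fun_prop)) ?_ ?_ ?_ ?_
  · refine key.2.congr_deriv ?_
    simp only [fderiv_eq_sum, PiLp.add_apply, PiLp.smul_apply, smul_eq_mul]
    have e : ∀ (z' : Euc n) (i : Fin n), (curveDeriv x z θ i + Real.cos θ * z' i) *
        pderiv i h ((1 : ℝ) • curve x z θ + Real.sin θ • z') =
        curveDeriv x z θ i * pderiv i h ((1 : ℝ) • curve x z θ + Real.sin θ • z') +
        Real.cos θ * (z' i * pderiv i h ((1 : ℝ) • curve x z θ + Real.sin θ • z')) :=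
      fun z' i => by ring
    have i1 : ∀ i, Integrable (fun z' => curveDeriv x z θ i *
        pderiv i h ((1 : ℝ) • curve x z θ + Real.sin θ • z')) (gauss n) := fun i =>
      ((hh.pderiv i).integrable_comp (by fun_prop)).const_mul _
    have i2 : ∀ i, Integrable (fun z' => Real.cos θ * (z' i *
        pderiv i h ((1 : ℝ) • curve x z θ + Real.sin θ • z'))) (gauss n) := fun i =>
      (integrable_coord_mul ((hh.pderiv i).comp_affine _ _) i integrable_id_gauss).const_mul _
    simp only [e]
    rw [integral_finsetSum]
    swap
    · exact fun i _ => (i1 i).add (i2 i)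
    refine Finset.sum_congr rfl fun i _ => ?_
    rw [integral_add (i1 i) (i2 i), integral_const_mul, integral_const_mul,
      integral_coord_mul_comp_affine (hh.pderiv i)]
    simp only [gAvg]
    ring
  · have : Continuous fun z' => fderiv ℝ h ((1 : ℝ) • curve x z θ + Real.sin θ • z')
      (curveDeriv x z θ + Real.cos θ • z') :=
      (hh.fderiv.continuous.comp (by fun_prop)).clm_apply (by fun_prop)
    exact this.aestronglyMeasurable
  · refine Eventually.of_forall fun z' t _ => ?_
    refine (ContinuousLinearMap.le_opNorm _ _).trans ?_
    refine mul_le_mul (hC _) ?_ (norm_nonneg _) hC0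
    refine (norm_add_le _ _).trans (add_le_add (norm_curveDeriv_le x z t) ?_)
    rw [norm_smul]
    exact mul_le_of_le_one_left (norm_nonneg _) (Real.abs_cos_le_one t)
  · exact ((integrable_const _).add integrable_id_gauss.norm).const_mul C
  · refine Eventually.of_forall fun z' t _ => ?_
    have h1 : HasDerivAt (fun t => (1 : ℝ) • curve x z t + Real.sin t • z')
        (curveDeriv x z t + Real.cos t • z') t := by
      have := ((hasDerivAt_curve x z t).const_smul (1 : ℝ)).add
        ((Real.hasDerivAt_sin t).smul_const z')
      simp only [one_smul] at this ⊢
      exact this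
    exact (hh.differentiable _).hasFDerivAt.comp_hasDerivAt t h1

/-- The logarithm of the Gaussian average `∫ h(y + s z) dγ(z)`. -/
noncomputable def logAvg (h : Euc n → ℝ) (s : ℝ) (y : Euc n) : ℝ := Real.log (gAvg 1 s h y)

/-! ### Derivatives of the logarithm of a Gaussian average -/

section logAvg

variable {h : Euc n → ℝ} {ε : ℝ}

lemma bddSmooth_logAvg (hh : BddSmooth h) (hε : 0 < ε) (hlow : ∀ x, ε ≤ h x) (s : ℝ) :
    BddSmooth (logAvg h s) :=
  (hh.gAvg 1 s).log hε (le_gAvg hh hlow 1 s)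

lemma pderiv_logAvg (hh : BddSmooth h) (hε : 0 < ε) (hlow : ∀ x, ε ≤ h x) (s : ℝ) (i : Fin n)
    (y : Euc n) : pderiv i (logAvg h s) y = gAvg 1 s (pderiv i h) y * (gAvg 1 s h y)⁻¹ := by
  have hpos : 0 < gAvg 1 s h y := hε.trans_le (le_gAvg hh hlow 1 s y)
  have h1 := (hasFDerivAt_gAvg hh 1 s y).log hpos.ne'
  have h2 := pderiv_gAvg hh 1 s i y
  rw [pderiv, (hasFDerivAt_gAvg hh 1 s y).fderiv] at h2
  rw [pderiv]
  unfold logAvg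
  rw [h1.fderiv, smul_apply, h2, smul_eq_mul]
  ring

/-- The squared gradient appearing here is the source of the quadratic term in the derivative of
`interp`. -/
lemma pderiv_pderiv_logAvg (hh : BddSmooth h) (hε : 0 < ε) (hlow : ∀ x, ε ≤ h x) (s : ℝ)
    (i : Fin n) (y : Euc n) : pderiv i (pderiv i (logAvg h s)) y =
      gAvg 1 s (pderiv i (pderiv i h)) y * (gAvg 1 s h y)⁻¹ - pderiv i (logAvg h s) y ^ 2 := by
  have hpos : 0 < gAvg 1 s h y := hε.trans_le (le_gAvg hh hlow 1 s y)
  have e : pderiv i (logAvg h s) = fun y => gAvg 1 s (pderiv i h) y * (gAvg 1 s h y)⁻¹ :=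
    funext fun y => pderiv_logAvg hh hε hlow s i y
  have d2 := (hasDerivAt_inv hpos.ne').comp_hasFDerivAt y (hasFDerivAt_gAvg hh 1 s y)
  have d3 : DifferentiableAt ℝ (fun y => (gAvg 1 s h y)⁻¹) y := d2.differentiableAt
  have h2 := pderiv_gAvg hh 1 s i y
  rw [pderiv, (hasFDerivAt_gAvg hh 1 s y).fderiv] at h2
  have e2 : pderiv i (fun y => (gAvg 1 s h y)⁻¹) y =
      -(gAvg 1 s h y ^ 2)⁻¹ * gAvg 1 s (pderiv i h) y := by
    have : (fun y => (gAvg 1 s h y)⁻¹) = (fun x => x⁻¹) ∘ gAvg 1 s h := rfl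
    rw [pderiv, this, d2.fderiv, smul_apply, h2, smul_eq_mul, one_mul]
  rw [e]
  beta_reduce
  rw [pderiv_mul ((hh.pderiv i).gAvg 1 s).differentiable.differentiableAt d3, e2, pderiv_gAvg (hh.pderiv i)]
  field_simp
  ring

/-- The derivative in `θ` of `logAvg h (sin θ) (curve x z θ)`. -/
noncomputable def logAvgDeriv (h : Euc n → ℝ) (θ : ℝ) (x z : Euc n) : ℝ :=
  ∑ i, (curveDeriv x z θ i * pderiv i (logAvg h (Real.sin θ)) (curve x z θ) +
    Real.cos θ * Real.sin θ * (pderiv i (pderiv i (logAvg h (Real.sin θ))) (curve x z θ) +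
      pderiv i (logAvg h (Real.sin θ)) (curve x z θ) ^ 2))

lemma logAvgDeriv_eq (hh : BddSmooth h) (hε : 0 < ε) (hlow : ∀ x, ε ≤ h x) (θ : ℝ)
    (x z : Euc n) : logAvgDeriv h θ x z =
    (∑ i, (curveDeriv x z θ i * gAvg 1 (Real.sin θ) (pderiv i h) (curve x z θ) +
        Real.cos θ * Real.sin θ * gAvg 1 (Real.sin θ) (pderiv i (pderiv i h)) (curve x z θ))) /
      gAvg 1 (Real.sin θ) h (curve x z θ) := by
  rw [logAvgDeriv, Finset.sum_div]
  refine Finset.sum_congr rfl fun i _ => ?_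
  rw [pderiv_pderiv_logAvg hh hε hlow, sub_add_cancel, pderiv_logAvg hh hε hlow]
  ring

lemma hasDerivAt_logAvg_curve (hh : BddSmooth h) (hε : 0 < ε) (hlow : ∀ x, ε ≤ h x)
    (x z : Euc n) (θ : ℝ) :
    HasDerivAt (fun θ => logAvg h (Real.sin θ) (curve x z θ)) (logAvgDeriv h θ x z) θ := by
  rw [logAvgDeriv_eq hh hε hlow]
  exact (hasDerivAt_gAvg_curve hh x z θ).log
    (hε.trans_le (le_gAvg hh hlow 1 _ _)).ne'

/-- A bound uniform in `θ` and of linear growth, hence integrable because `ν` and the Gaussian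
measure have first moments; it justifies differentiating `interp` under the integral. -/
lemma exists_logAvgDeriv_le (hh : BddSmooth h) (hε : 0 < ε) (hlow : ∀ x, ε ≤ h x) :
    ∃ C : ℝ, ∀ θ (x z : Euc n), |logAvgDeriv h θ x z| ≤ C * (‖x‖ + ‖z‖ + 1) := by
  choose C1 hC10 hC1 using fun i => (hh.pderiv i).bounded
  choose C2 hC20 hC2 using fun i => ((hh.pderiv i).pderiv i).bounded
  refine ⟨(∑ i, (C1 i + C2 i)) / ε, fun θ x z => ?_⟩
  rw [logAvgDeriv_eq hh hε hlow, abs_div, div_mul_eq_mul_div]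
  have hV := le_gAvg hh hlow 1 (Real.sin θ) (curve x z θ)
  rw [abs_of_pos (hε.trans_le hV)]
  refine div_le_div₀ (mul_nonneg (Finset.sum_nonneg fun i _ => add_nonneg (hC10 i) (hC20 i))
    (by positivity)) ?_ hε hV
  refine (Finset.abs_sum_le_sum_abs _ _).trans ?_
  rw [Finset.sum_mul]
  refine Finset.sum_le_sum fun i _ => (abs_add_le _ _).trans ?_
  have hxz : 0 ≤ ‖x‖ + ‖z‖ := by positivity
  have b1 : |curveDeriv x z θ i * gAvg 1 (Real.sin θ) (pderiv i h) (curve x z θ)| ≤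
      (‖x‖ + ‖z‖) * C1 i := by
    rw [abs_mul]
    exact mul_le_mul ((PiLp.norm_apply_le (curveDeriv x z θ) i).trans (norm_curveDeriv_le x z θ))
      (abs_gAvg_le (hC1 i) _ _ _) (abs_nonneg _) hxz
  have b2 : |Real.cos θ * Real.sin θ * gAvg 1 (Real.sin θ) (pderiv i (pderiv i h)) (curve x z θ)| ≤
      1 * C2 i := by
    rw [abs_mul, abs_mul]
    exact mul_le_mul (mul_le_one₀ (Real.abs_cos_le_one θ) (abs_nonneg _) (Real.abs_sin_le_one θ))
      (abs_gAvg_le (hC2 i) _ _ _) (abs_nonneg _) zero_le_one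
  have := mul_nonneg hxz (hC20 i)
  nlinarith [hC10 i, hC20 i]

lemma continuous_logAvgDeriv (hh : BddSmooth h) (hε : 0 < ε) (hlow : ∀ x, ε ≤ h x) (θ : ℝ) :
    Continuous fun p : Euc n × Euc n => logAvgDeriv h θ p.1 p.2 := by
  have hF := bddSmooth_logAvg hh hε hlow (Real.sin θ)
  have h0 := continuous_curve (n := n) θ
  have h1 := continuous_curveDeriv (n := n) θ
  unfold logAvgDeriv
  refine continuous_finsetSum _ fun i _ => ?_
  have h2 := (hF.pderiv i).continuous.comp h0
  have h3 := ((hF.pderiv i).pderiv i).continuous.comp h0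
  have h4 : Continuous fun p : Euc n × Euc n => curveDeriv p.1 p.2 θ i :=
    (EuclideanSpace.proj i : Euc n →L[ℝ] ℝ).continuous.comp h1
  exact (h4.mul h2).add (continuous_const.mul (h3.add (h2.pow 2)))

end logAvg

/-- The interpolation between `∫ log h dν` at `θ = 0` and `log ∫ h dγ` at `θ = π / 2`. -/
noncomputable def interp (ν : Measure (Euc n)) (h : Euc n → ℝ) (θ : ℝ) : ℝ :=
  ∫ p : Euc n × Euc n, logAvg h (Real.sin θ) (curve p.1 p.2 θ) ∂(ν.prod (gauss n))


/-- Write `c = cos θ`, `s = sin θ`. Integration by parts in `z` turns the term with `z i` into `(c²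
- s²) c s` times the average of the second derivative of `F`. Together with the existing `c s` this
makes `2 c³ s`. As differentiating an average brings out `c²`, the result has the form `∂ᵢ w - xᵢ
w`, ready for integration by parts against `ν`. -/
lemma integral_logAvgDeriv {h : Euc n → ℝ} {ε : ℝ} (hh : BddSmooth h) (hε : 0 < ε)
    (hlow : ∀ x, ε ≤ h x) (θ : ℝ) (x : Euc n) :
    ∫ z, logAvgDeriv h θ x z ∂(gauss n) = Real.cos θ * Real.sin θ * ∑ i,
      (2 * (pderiv i (gAvg (Real.cos θ ^ 2) (Real.cos θ * Real.sin θ)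
          (pderiv i (logAvg h (Real.sin θ)))) x -
        x i * gAvg (Real.cos θ ^ 2) (Real.cos θ * Real.sin θ)
          (pderiv i (logAvg h (Real.sin θ))) x) +
        gAvg (Real.cos θ ^ 2) (Real.cos θ * Real.sin θ)
          (fun y => pderiv i (logAvg h (Real.sin θ)) y ^ 2) x) := by
  have hF := bddSmooth_logAvg hh hε hlow (Real.sin θ)
  set F := logAvg h (Real.sin θ) with hFdef
  set c := Real.cos θ with hc
  set s := Real.sin θ with hs
  have hcs : s ^ 2 + c ^ 2 = 1 := Real.sin_sq_add_cos_sq θ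
  have i1 : ∀ i, Integrable (fun z => pderiv i F (c ^ 2 • x + (c * s) • z)) (gauss n) := fun i =>
    (hF.pderiv i).integrable_comp (by fun_prop)
  have i2 : ∀ i, Integrable (fun z => z i * pderiv i F (c ^ 2 • x + (c * s) • z)) (gauss n) :=
    fun i => integrable_coord_mul ((hF.pderiv i).comp_affine _ _) i integrable_id_gauss
  have i3 : ∀ i, Integrable (fun z => pderiv i (pderiv i F) (c ^ 2 • x + (c * s) • z)) (gauss n) :=
    fun i => ((hF.pderiv i).pderiv i).integrable_comp (by fun_prop)
  have i4 : ∀ i, Integrable (fun z => pderiv i F (c ^ 2 • x + (c * s) • z) ^ 2) (gauss n) :=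
    fun i => (hF.pderiv i).integrable_sq (by fun_prop)
  have e : ∀ z, logAvgDeriv h θ x z = ∑ i,
      (((-2 * c * s * x i) * pderiv i F (c ^ 2 • x + (c * s) • z) +
        (c ^ 2 - s ^ 2) * (z i * pderiv i F (c ^ 2 • x + (c * s) • z))) +
        ((c * s) * pderiv i (pderiv i F) (c ^ 2 • x + (c * s) • z) +
        (c * s) * pderiv i F (c ^ 2 • x + (c * s) • z) ^ 2)) := by
    intro z
    refine Finset.sum_congr rfl fun i _ => ?_
    simp only [curveDeriv, curve, PiLp.add_apply, PiLp.smul_apply, smul_eq_mul, ← hc, ← hs,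
      ← hFdef]
    ring
  simp only [e]
  have j1 := fun i => ((i1 i).const_mul (-2 * c * s * x i)).add ((i2 i).const_mul (c ^ 2 - s ^ 2))
  have j2 := fun i => ((i3 i).const_mul (c * s)).add ((i4 i).const_mul (c * s))
  rw [integral_finsetSum]
  swap
  · exact fun i _ => (j1 i).add (j2 i)
  rw [Finset.mul_sum]
  refine Finset.sum_congr rfl fun i _ => ?_
  have k1 := integral_add (j1 i) (j2 i)
  simp only [Pi.add_apply] at k1
  rw [k1, integral_add ((i1 i).const_mul _) ((i2 i).const_mul _),
    integral_add ((i3 i).const_mul _) ((i4 i).const_mul _), integral_const_mul, integral_const_mul,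
    integral_const_mul, integral_const_mul, integral_coord_mul_comp_affine (hF.pderiv i),
    pderiv_gAvg (hF.pderiv i)]
  simp only [gAvg]
  have hs2 : s ^ 2 = 1 - c ^ 2 := by linarith
  rw [hs2]
  ring

lemma HasFiniteInfo.hasDerivAt_interp {l : ℝ} {ν : Measure (Euc n)} {f : Euc n → ℝ}
    {G : Euc n → Euc n} (H : HasFiniteInfo l ν f G) {h : Euc n → ℝ} {ε : ℝ} (hh : BddSmooth h)
    (hε : 0 < ε) (hlow : ∀ x, ε ≤ h x) (θ : ℝ) :
    HasDerivAt (interp ν h) (Real.cos θ * Real.sin θ * ∑ i,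
      (∫ x, gAvg (Real.cos θ ^ 2) (Real.cos θ * Real.sin θ)
          (fun y => pderiv i (logAvg h (Real.sin θ)) y ^ 2) x ∂ν -
        2 * ∫ x, gAvg (Real.cos θ ^ 2) (Real.cos θ * Real.sin θ)
          (pderiv i (logAvg h (Real.sin θ))) x * G x i ∂(gauss n))) θ := by
  have := H.isProbabilityMeasure
  obtain ⟨C, hC⟩ := exists_logAvgDeriv_le hh hε hlow
  have hF := fun s => bddSmooth_logAvg hh hε hlow s
  have key := hasDerivAt_integral_of_dominated_loc_of_deriv_le (μ := ν.prod (gauss n)) (x₀ := θ)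
    (F := fun θ p => logAvg h (Real.sin θ) (curve p.1 p.2 θ))
    (F' := fun θ p => logAvgDeriv h θ p.1 p.2)
    (bound := fun p => C * (‖p.1‖ + ‖p.2‖ + 1)) (s := Set.univ) univ_mem
    (Eventually.of_forall fun t =>
      ((hF _).integrable_comp (continuous_curve t).measurable).aestronglyMeasurable)
    ((hF _).integrable_comp (continuous_curve θ).measurable)
    (continuous_logAvgDeriv hh hε hlow θ).aestronglyMeasurable
    (Eventually.of_forall fun p t _ => hC t p.1 p.2)
    (((((H.centered.integrable.norm).comp_fst (gauss n)).add
      ((integrable_id_gauss.norm).comp_snd ν)).add (integrable_const _)).const_mul C)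
    (Eventually.of_forall fun p t _ => hasDerivAt_logAvg_curve hh hε hlow p.1 p.2 t)
  refine key.2.congr_deriv ?_
  rw [integral_prod _ key.1]
  simp only [integral_logAvgDeriv hh hε hlow]
  have hw := fun i => ((hF (Real.sin θ)).pderiv i).gAvg (Real.cos θ ^ 2) (Real.cos θ * Real.sin θ)
  have hA := fun i => ((hF (Real.sin θ)).pderiv i).integrable_gAvg_sq (Real.cos θ ^ 2)
    (Real.cos θ * Real.sin θ) (ν := ν)
  have j := fun i => ((hw i).pderiv i).integrable (μ := ν) |>.sub
    (integrable_coord_mul (hw i) i H.centered.integrable)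
  rw [integral_const_mul, integral_finsetSum]
  swap
  · exact fun i _ => ((j i).const_mul 2).add (hA i)
  congr 1
  refine Finset.sum_congr rfl fun i _ => ?_
  have k := integral_add ((j i).const_mul 2) (hA i)
  simp only [Pi.sub_apply] at k
  -- The weak gradient of `f` enters here and replaces the last derivative falling on the average.
  rw [k, integral_const_mul, H.integral_by_parts (hw i) i]
  ring

lemma HasFiniteInfo.deriv_interp_ge {l : ℝ} {ν : Measure (Euc n)} {f : Euc n → ℝ}
    {G : Euc n → Euc n} (H : HasFiniteInfo l ν f G) {h : Euc n → ℝ} {ε : ℝ} (hh : BddSmooth h)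
    (hε : 0 < ε) (hlow : ∀ x, ε ≤ h x) {θ : ℝ} (hθ : θ ∈ Set.Ioo 0 (Real.pi / 2)) :
    -(Real.cos θ * Real.sin θ * ((∫ x, ‖G x‖ ^ 2 / f x ∂(gauss n)) /
      (1 + l * Real.sin θ ^ 2 / Real.cos θ ^ 2))) ≤ deriv (interp ν h) θ := by
  rw [(H.hasDerivAt_interp hh hε hlow θ).deriv, ← mul_neg]
  have hc : 0 < Real.cos θ := Real.cos_pos_of_mem_Ioo ⟨by linarith [hθ.1, Real.pi_pos], hθ.2⟩
  have hs : 0 < Real.sin θ := Real.sin_pos_of_pos_of_lt_pi hθ.1 (by linarith [hθ.2, Real.pi_pos])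
  refine mul_le_mul_of_nonneg_left ?_ (by positivity)
  rw [← H.sum_info, Finset.sum_div, ← Finset.sum_neg_distrib]
  refine Finset.sum_le_sum fun i _ => ?_
  have := coordinate_bound H.measurable H.nonneg H.eq_withDensity H.mem (g := fun x => G x i)
    ((EuclideanSpace.proj i : Euc n →L[ℝ] ℝ).integrable_comp H.integrable_grad)
    (H.integral_grad i) (by
      filter_upwards [H.grad_eq_zero] with x hx h0
      simp [hx h0]) (H.integrable_info_coord i)
    ((bddSmooth_logAvg hh hε hlow (Real.sin θ)).pderiv i) (c := Real.cos θ) (s := Real.sin θ) hc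
  linarith

lemma HasFiniteInfo.interp_zero {l : ℝ} {ν : Measure (Euc n)} {f : Euc n → ℝ}
    {G : Euc n → Euc n} (H : HasFiniteInfo l ν f G) (h : Euc n → ℝ) :
    interp ν h 0 = ∫ x, Real.log (h x) ∂ν := by
  have := H.isProbabilityMeasure
  have e : ∀ p : Euc n × Euc n, logAvg h (Real.sin 0) (curve p.1 p.2 0) = Real.log (h p.1) := by
    intro p
    simp [logAvg, gAvg, curve]
  simp only [interp, e]
  have := integral_fun_fst (μ := ν) (ν := gauss n) (fun x => Real.log (h x))
  simpa using this

lemma HasFiniteInfo.interp_pi_div_two {l : ℝ} {ν : Measure (Euc n)} {f : Euc n → ℝ}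
    {G : Euc n → Euc n} (H : HasFiniteInfo l ν f G) (h : Euc n → ℝ) :
    interp ν h (Real.pi / 2) = Real.log (∫ x, h x ∂(gauss n)) := by
  have := H.isProbabilityMeasure
  have e : ∀ p : Euc n × Euc n, logAvg h (Real.sin (Real.pi / 2)) (curve p.1 p.2 (Real.pi / 2)) =
      Real.log (∫ x, h x ∂(gauss n)) := by
    intro p
    simp [logAvg, gAvg, curve]
  simp only [interp, e]
  simp

/-! ### The constant -/

/-- Under `u = cos² θ`, the factor `cos θ sin θ / (1 + l tan² θ)` integrated over `[0, π/2]` becomes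
the integral of this derivative over `[0, 1]`. -/
lemma exists_primitive {l : ℝ} (hl : 0 < l) : ∃ K : ℝ → ℝ,
    (∀ u ∈ Set.Icc (0 : ℝ) 1, HasDerivAt K (u / (2 * (u + l * (1 - u)))) u) ∧
    K 1 - K 0 = lsiConst l / 2 := by
  by_cases h1 : l = 1
  · refine ⟨fun u => u ^ 2 / 4, fun u _ => ?_, ?_⟩
    · convert! ((hasDerivAt_id u).pow 2).div_const 4 using 1
      simp [h1]
      ring
    · simp [lsiConst, h1]; norm_num
  · have h1' : 1 - l ≠ 0 := sub_ne_zero.2 (Ne.symm h1)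
    refine ⟨fun u => (1 / 2) * (u / (1 - l) - l / (1 - l) ^ 2 * Real.log (u + l * (1 - u))),
      fun u hu => ?_, ?_⟩
    · have hD : 0 < u + l * (1 - u) := by
        rcases hu.1.eq_or_lt with h | h
        · rw [← h]; simpa using hl
        · have := mul_nonneg hl.le (sub_nonneg.2 hu.2)
          linarith
      have hd : HasDerivAt (fun u => u + l * (1 - u)) (1 + l * (0 - 1)) u :=
        (hasDerivAt_id u).add (((hasDerivAt_const u 1).sub (hasDerivAt_id u)).const_mul l)
      have := (((hasDerivAt_id u).div_const (1 - l)).sub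
        ((hd.log hD.ne').const_mul (l / (1 - l) ^ 2))).const_mul (1 / 2 : ℝ)
      convert! this using 1
      field_simp
      ring
    · simp only [lsiConst, h1, if_false]
      simp
      field_simp

/-- From `log l ≤ l - 1` the numerator is at most `1 - l + l (l - 1) = (1 - l)²`. -/
lemma lsiConst_le_one {l : ℝ} (hl : 0 < l) : lsiConst l ≤ 1 := by
  by_cases h1 : l = 1
  · simp [lsiConst, h1]; norm_num
  · have h1' : 1 - l ≠ 0 := sub_ne_zero.2 (Ne.symm h1)
    simp only [lsiConst, h1, if_false]
    rw [div_le_one (by positivity)]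
    have := Real.log_le_sub_one_of_pos hl
    nlinarith

/-! ### The entropy inequality -/

lemma HasFiniteInfo.integral_log_le {l : ℝ} {ν : Measure (Euc n)} {f : Euc n → ℝ}
    {G : Euc n → Euc n} (H : HasFiniteInfo l ν f G) {h : Euc n → ℝ} {ε : ℝ} (hh : BddSmooth h)
    (hε : 0 < ε) (hlow : ∀ x, ε ≤ h x) :
    ∫ x, Real.log (h x) ∂ν ≤ Real.log (∫ x, h x ∂(gauss n)) +
      lsiConst l / 2 * ∫ x, ‖G x‖ ^ 2 / f x ∂(gauss n) := by
  obtain ⟨K, hK, hK1⟩ := exists_primitive H.mem.pos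
  set J := ∫ x, ‖G x‖ ^ 2 / f x ∂(gauss n) with hJ
  have hl := H.mem.pos
  have hd : ∀ θ, HasDerivAt (fun θ => interp ν h θ - J * K (Real.cos θ ^ 2))
      (deriv (interp ν h) θ - J * (Real.cos θ ^ 2 /
        (2 * (Real.cos θ ^ 2 + l * (1 - Real.cos θ ^ 2))) *
        (2 * Real.cos θ * (-Real.sin θ)))) θ := by
    intro θ
    have h1 := (H.hasDerivAt_interp hh hε hlow θ).differentiableAt.hasDerivAt
    have hu : Real.cos θ ^ 2 ∈ Set.Icc (0 : ℝ) 1 := ⟨sq_nonneg _, Real.cos_sq_le_one θ⟩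
    have h2 : HasDerivAt (fun θ => Real.cos θ ^ 2) (2 * Real.cos θ * (-Real.sin θ)) θ := by
      convert! (Real.hasDerivAt_cos θ).pow 2 using 1
      simp
    exact h1.sub (((hK _ hu).comp θ h2).const_mul J)
  -- Since `cos² θ` decreases, subtracting `J K(cos² θ)` adds to the derivative exactly the lower
  -- bound with its sign reversed. Comparing the endpoints then gives the inequality.
  have hmono : MonotoneOn (fun θ => interp ν h θ - J * K (Real.cos θ ^ 2))
      (Set.Icc 0 (Real.pi / 2)) := by
    refine monotoneOn_of_deriv_nonneg (convex_Icc _ _)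
      (fun θ _ => (hd θ).continuousAt.continuousWithinAt)
      (fun θ _ => (hd θ).differentiableAt.differentiableWithinAt) fun θ hθ => ?_
    rw [interior_Icc] at hθ
    rw [(hd θ).deriv]
    have hc : 0 < Real.cos θ := Real.cos_pos_of_mem_Ioo ⟨by linarith [hθ.1, Real.pi_pos], hθ.2⟩
    have h1 := H.deriv_interp_ge hh hε hlow hθ
    rw [← hJ] at h1
    have hs2 : 1 - Real.cos θ ^ 2 = Real.sin θ ^ 2 := by
      linarith [Real.sin_sq_add_cos_sq θ]
    rw [hs2]
    have e : J * (Real.cos θ ^ 2 / (2 * (Real.cos θ ^ 2 + l * Real.sin θ ^ 2)) *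
        (2 * Real.cos θ * (-Real.sin θ))) =
        -(Real.cos θ * Real.sin θ * (J / (1 + l * Real.sin θ ^ 2 / Real.cos θ ^ 2))) := by
      have : 0 < Real.cos θ ^ 2 + l * Real.sin θ ^ 2 := by positivity
      have e2 : 1 + l * Real.sin θ ^ 2 / Real.cos θ ^ 2 =
          (Real.cos θ ^ 2 + l * Real.sin θ ^ 2) / Real.cos θ ^ 2 := by
        field_simp
      rw [e2]
      field_simp
    rw [e]
    linarith
  have hp : (0 : ℝ) ≤ Real.pi / 2 := by positivity
  have := hmono (Set.left_mem_Icc.2 hp) (Set.right_mem_Icc.2 hp) hp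
  simp only [Real.cos_zero, Real.cos_pi_div_two, H.interp_zero, H.interp_pi_div_two] at this
  rw [← hK1]
  norm_num at this
  linarith

/-- The inequality for functions that need not be smooth. -/
lemma HasFiniteInfo.integral_log_add_le {l : ℝ} {ν : Measure (Euc n)} {f : Euc n → ℝ}
    {G : Euc n → Euc n} (H : HasFiniteInfo l ν f G) {g : Euc n → ℝ} {ε M : ℝ}
    (hg : Measurable g) (hg0 : ∀ x, 0 ≤ g x) (hgM : ∀ x, g x ≤ M) (hgc : HasCompactSupport g)
    (hε : 0 < ε) :
    ∫ x, Real.log (ε + g x) ∂ν ≤ Real.log (ε + ∫ x, g x ∂(gauss n)) +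
      lsiConst l / 2 * ∫ x, ‖G x‖ ^ 2 / f x ∂(gauss n) := by
  have := H.isProbabilityMeasure
  have hM : 0 ≤ M := (hg0 0).trans (hgM 0)
  have hgb : ∀ x, ‖g x‖ ≤ M := fun x => by rw [Real.norm_of_nonneg (hg0 x)]; exact hgM x
  have hgl : LocallyIntegrable g volume := fun x =>
    ⟨Metric.closedBall x 1, Metric.closedBall_mem_nhds x one_pos,
      Measure.integrableOn_of_bounded (isCompact_closedBall x 1).measure_ne_top
        hg.aestronglyMeasurable (Eventually.of_forall hgb)⟩
  let φ : ℕ → ContDiffBump (0 : Euc n) := fun k =>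
    ⟨((k : ℝ) + 1)⁻¹, 2 * ((k : ℝ) + 1)⁻¹, by positivity, by
      have : (0 : ℝ) < ((k : ℝ) + 1)⁻¹ := by positivity
      linarith⟩
  have hk0 : Tendsto (fun k : ℕ => ((k : ℝ) + 1)⁻¹) atTop (𝓝 0) := by
    simpa using tendsto_one_div_add_atTop_nhds_zero_nat (𝕜 := ℝ)
  -- The mollifications of `g` are smooth with compact support, keep the bounds `0` and `M`, and
  -- converge Lebesgue-almost everywhere, hence `ν`-almost everywhere.
  let gk : ℕ → Euc n → ℝ := fun k =>
    MeasureTheory.convolution ((φ k).normed volume) g (ContinuousLinearMap.lsmul ℝ ℝ) volume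
  have hconv : ∀ᵐ x ∂(volume : Measure (Euc n)), Tendsto (fun k => gk k x) atTop (𝓝 (g x)) := by
    refine ContDiffBump.ae_convolution_tendsto_right_of_locallyIntegrable (K := 2) ?_
      (Eventually.of_forall fun k => le_rfl) hgl
    simpa [φ] using hk0.const_mul 2
  have hgk : ∀ k, BddSmooth (gk k) := fun k =>
    BddSmooth.of_hasCompactSupport
      ((φ k).hasCompactSupport_normed.contDiff_convolution_left _ (φ k).contDiff_normed hgl)
      ((φ k).hasCompactSupport_normed.convolution _ hgc)
  have hgk0 : ∀ k x, 0 ≤ gk k x := fun k x =>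
    integral_nonneg fun t => mul_nonneg ((φ k).nonneg_normed t) (hg0 _)
  have hgkM : ∀ k x, gk k x ≤ M := fun k x => by
    have h1 : gk k x ≤ ∫ t, (φ k).normed volume t * M := by
      refine integral_mono_of_nonneg
        (Eventually.of_forall fun t => mul_nonneg ((φ k).nonneg_normed t) (hg0 _))
        ((φ k).integrable_normed.mul_const M)
        (Eventually.of_forall fun t => mul_le_mul_of_nonneg_left (hgM _) ((φ k).nonneg_normed t))
    rwa [integral_mul_const, (φ k).integral_normed, one_mul] at h1
  have hlog : ∀ y : ℝ, 0 ≤ y → y ≤ M → ‖Real.log (ε + y)‖ ≤ |Real.log ε| + |Real.log (ε + M)| := by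
    intro y h0 h1
    rw [Real.norm_eq_abs, abs_le]
    have a1 := Real.log_le_log hε (show ε ≤ ε + y by linarith)
    have a2 := Real.log_le_log (show 0 < ε + y by linarith) (show ε + y ≤ ε + M by linarith)
    have a3 := neg_abs_le (Real.log ε)
    have a4 := le_abs_self (Real.log (ε + M))
    have a5 := abs_nonneg (Real.log ε)
    have a6 := abs_nonneg (Real.log (ε + M))
    constructor <;> linarith
  have hνγ : ν ≪ gauss n := by
    rw [H.eq_withDensity]; exact withDensity_absolutelyContinuous _ _
  have hconvγ := gauss_absolutelyContinuous.ae_le hconv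
  have hconvν := hνγ.ae_le hconvγ
  have lim1 : Tendsto (fun k => ∫ x, Real.log (ε + gk k x) ∂ν) atTop
      (𝓝 (∫ x, Real.log (ε + g x) ∂ν)) := by
    refine tendsto_integral_of_dominated_convergence
      (fun _ => |Real.log ε| + |Real.log (ε + M)|) (fun k => ?_) (integrable_const _)
      (fun k => Eventually.of_forall fun x => hlog _ (hgk0 k x) (hgkM k x)) ?_
    · exact ((hgk k).continuous.measurable.const_add ε).log.aestronglyMeasurable
    · filter_upwards [hconvν] with x hx
      exact (hx.const_add ε).log (by have := hg0 x; positivity)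
  have lim2 : Tendsto (fun k => ∫ x, gk k x ∂(gauss n)) atTop (𝓝 (∫ x, g x ∂(gauss n))) := by
    refine tendsto_integral_of_dominated_convergence (fun _ => M)
      (fun k => (hgk k).continuous.aestronglyMeasurable) (integrable_const _)
      (fun k => Eventually.of_forall fun x => ?_) hconvγ
    rw [Real.norm_of_nonneg (hgk0 k x)]
    exact hgkM k x
  have hpos : 0 ≤ ∫ x, g x ∂(gauss n) := integral_nonneg hg0
  have lim3 := ((lim2.const_add ε).log (by positivity)).add_const
    (lsiConst l / 2 * ∫ x, ‖G x‖ ^ 2 / f x ∂(gauss n))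
  refine le_of_tendsto_of_tendsto' lim1 lim3 fun k => ?_
  have := H.integral_log_le ((hgk k).const_add ε) hε fun x => by linarith [hgk0 k x]
  rwa [integral_add (integrable_const _) (hgk k).integrable, integral_const, probReal_univ,
    one_smul] at this

/-- `1_{|x| ≤ N} min(f, N)`. -/
noncomputable def truncation (f : Euc n → ℝ) (N : ℕ) : Euc n → ℝ :=
  (Metric.closedBall (0 : Euc n) N).indicator fun x => min (f x) N

/-! ### Truncations of the density -/

section truncation

variable {f : Euc n → ℝ}

lemma truncation_nonneg (hf : ∀ x, 0 ≤ f x) (N : ℕ) (x : Euc n) : 0 ≤ truncation f N x :=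
  Set.indicator_nonneg (fun x _ => le_min (hf x) (Nat.cast_nonneg N)) x

lemma truncation_le (hf : ∀ x, 0 ≤ f x) (N : ℕ) (x : Euc n) : truncation f N x ≤ f x :=
  Set.indicator_le' (fun _ _ => min_le_left _ _) (fun x _ => hf x) x

lemma truncation_le_natCast (N : ℕ) (x : Euc n) : truncation f N x ≤ N :=
  Set.indicator_le' (fun _ _ => min_le_right _ _) (fun _ _ => Nat.cast_nonneg N) x

lemma monotone_truncation (hf : ∀ x, 0 ≤ f x) (x : Euc n) :
    Monotone fun N => truncation f N x := by
  intro N N' h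
  have h' : (N : ℝ) ≤ N' := by exact_mod_cast h
  by_cases hx : x ∈ Metric.closedBall (0 : Euc n) N
  · have hx' : x ∈ Metric.closedBall (0 : Euc n) N' := Metric.closedBall_subset_closedBall h' hx
    simp only [truncation, Set.indicator_of_mem hx, Set.indicator_of_mem hx']
    exact min_le_min_left _ h'
  · simp only [truncation, Set.indicator_of_notMem hx]
    exact truncation_nonneg hf N' x

lemma tendsto_truncation (x : Euc n) : Tendsto (fun N => truncation f N x) atTop (𝓝 (f x)) := by
  refine tendsto_const_nhds.congr' ?_
  filter_upwards [eventually_ge_atTop ⌈max ‖x‖ (f x)⌉₊] with N hN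
  have h := Nat.ceil_le.1 hN
  rw [truncation, Set.indicator_of_mem (by simpa using (le_max_left _ _).trans h),
    min_eq_left ((le_max_right _ _).trans h)]

lemma measurable_truncation (hf : Measurable f) (N : ℕ) : Measurable (truncation f N) :=
  (hf.min measurable_const).indicator measurableSet_closedBall

lemma hasCompactSupport_truncation (N : ℕ) : HasCompactSupport (truncation f N) :=
  HasCompactSupport.intro (isCompact_closedBall (0 : Euc n) N) fun _ hx =>
    Set.indicator_of_notMem hx _

end truncation

/-- The truncation has Gaussian integral at most `∫ f dγ = 1`, so the bound does not depend on `N`.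
-/
lemma HasFiniteInfo.integral_log_truncation_le {l : ℝ} {ν : Measure (Euc n)} {f : Euc n → ℝ}
    {G : Euc n → Euc n} (H : HasFiniteInfo l ν f G) {ε : ℝ} (hε : 0 < ε) (N : ℕ) :
    ∫ x, f x * Real.log (ε + truncation f N x) ∂(gauss n) ≤ Real.log (ε + 1) +
      lsiConst l / 2 * ∫ x, ‖G x‖ ^ 2 / f x ∂(gauss n) := by
  have h := H.integral_log_add_le (measurable_truncation H.measurable N)
    (truncation_nonneg H.nonneg N) (truncation_le_natCast N) (hasCompactSupport_truncation N) hε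
  rw [H.integral_eq] at h
  simp only [mul_comm (f _)]
  refine h.trans (add_le_add_left (Real.log_le_log ?_ ?_) _)
  · have : 0 ≤ ∫ x, truncation f N x ∂(gauss n) := integral_nonneg (truncation_nonneg H.nonneg N)
    positivity
  · rw [← H.integral_eq_one]
    refine add_le_add_right (integral_mono_of_nonneg
      (Eventually.of_forall (truncation_nonneg H.nonneg N)) H.integrable
      (Eventually.of_forall (truncation_le H.nonneg N))) ε

/-- With `ε = 1` the integrands are nonnegative and increase with `N`, so the uniform bound passes
to the limit by monotone convergence. No finiteness of entropy is assumed beforehand. -/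
lemma HasFiniteInfo.integrable_mul_log_one_add {l : ℝ} {ν : Measure (Euc n)} {f : Euc n → ℝ}
    {G : Euc n → Euc n} (H : HasFiniteInfo l ν f G) :
    Integrable (fun x => f x * Real.log (1 + f x)) (gauss n) := by
  have hmeas : ∀ N, Measurable fun x => f x * Real.log (1 + truncation f N x) := fun N =>
    H.measurable.mul ((measurable_truncation H.measurable N).const_add 1).log
  have hnn : ∀ N x, 0 ≤ f x * Real.log (1 + truncation f N x) := fun N x =>
    mul_nonneg (H.nonneg x) (Real.log_nonneg (by linarith [truncation_nonneg H.nonneg N x]))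
  have hnn' : ∀ x, 0 ≤ f x * Real.log (1 + f x) := fun x =>
    mul_nonneg (H.nonneg x) (Real.log_nonneg (by linarith [H.nonneg x]))
  have hint : ∀ N, Integrable (fun x => f x * Real.log (1 + truncation f N x)) (gauss n) := by
    intro N
    refine (H.integrable.mul_const (Real.log (1 + N))).mono (hmeas N).aestronglyMeasurable
      (Eventually.of_forall fun x => ?_)
    have h0 := truncation_nonneg H.nonneg N x
    have h1 : Real.log (1 + truncation f N x) ≤ Real.log (1 + N) :=
      Real.log_le_log (by linarith) (by linarith [truncation_le_natCast (f := f) N x])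
    have h2 := mul_le_mul_of_nonneg_left h1 (H.nonneg x)
    rw [Real.norm_of_nonneg (hnn N x), Real.norm_of_nonneg ((hnn N x).trans h2)]
    exact h2
  have hmeas' : Measurable fun x => f x * Real.log (1 + f x) :=
    H.measurable.mul (H.measurable.const_add 1).log
  refine ⟨hmeas'.aestronglyMeasurable, ?_⟩
  rw [hasFiniteIntegral_iff_ofReal (Eventually.of_forall hnn')]
  have hlim := lintegral_tendsto_of_tendsto_of_monotone (μ := gauss n)
    (f := fun N x => ENNReal.ofReal (f x * Real.log (1 + truncation f N x)))
    (F := fun x => ENNReal.ofReal (f x * Real.log (1 + f x)))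
    (fun N => (hmeas N).ennreal_ofReal.aemeasurable)
    (Eventually.of_forall fun x N N' h => ENNReal.ofReal_le_ofReal
      (mul_le_mul_of_nonneg_left (Real.log_le_log
        (by linarith [truncation_nonneg H.nonneg N x])
        (by linarith [monotone_truncation H.nonneg x h])) (H.nonneg x)))
    (Eventually.of_forall fun x => ENNReal.tendsto_ofReal
      ((((tendsto_truncation x).const_add 1).log (by linarith [H.nonneg x])).const_mul (f x)))
  refine lt_of_le_of_lt (le_of_tendsto' hlim (b := ENNReal.ofReal (Real.log (1 + 1) +
      lsiConst l / 2 * ∫ x, ‖G x‖ ^ 2 / f x ∂(gauss n))) fun N => ?_) ENNReal.ofReal_lt_top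
  rw [← ofReal_integral_eq_lintegral_ofReal (hint N) (Eventually.of_forall (hnn N))]
  exact ENNReal.ofReal_le_ofReal (H.integral_log_truncation_le one_pos N)

/-- Pointwise, `f - 1 ≤ f log f ≤ f log (1 + f)`. -/
lemma HasFiniteInfo.integrable_mul_log {l : ℝ} {ν : Measure (Euc n)} {f : Euc n → ℝ}
    {G : Euc n → Euc n} (H : HasFiniteInfo l ν f G) :
    Integrable (fun x => f x * Real.log (f x)) (gauss n) := by
  refine (H.integrable_mul_log_one_add.add (integrable_const 1)).mono
    (H.measurable.mul H.measurable.log).aestronglyMeasurable (Eventually.of_forall fun x => ?_)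
  have h0 := H.nonneg x
  have h1 : 0 ≤ f x * Real.log (1 + f x) := mul_nonneg h0 (Real.log_nonneg (by linarith))
  simp only [Pi.add_apply]
  rw [Real.norm_of_nonneg (show 0 ≤ f x * Real.log (1 + f x) + 1 by linarith), Real.norm_eq_abs,
    abs_le]
  rcases h0.eq_or_lt with h | h
  · rw [← h]; simp
  · have a1 := Real.log_le_log h (show f x ≤ 1 + f x by linarith)
    have a2 := mul_le_mul_of_nonneg_left a1 h0
    have a3 := Real.one_sub_inv_le_log_of_pos h
    have a4 := mul_le_mul_of_nonneg_left a3 h0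
    rw [mul_sub, mul_inv_cancel₀ h.ne'] at a4
    constructor <;> linarith

/-- The improved logarithmic Sobolev inequality `H ≤ c(l) / 2 ∫ |G|² / f dγ`. -/
lemma HasFiniteInfo.entropy_le {l : ℝ} {ν : Measure (Euc n)} {f : Euc n → ℝ}
    {G : Euc n → Euc n} (H : HasFiniteInfo l ν f G) :
    entropy f ≤ lsiConst l / 2 * ∫ x, ‖G x‖ ^ 2 / f x ∂(gauss n) := by
  set B := lsiConst l / 2 * ∫ x, ‖G x‖ ^ 2 / f x ∂(gauss n) with hB
  have hdom := (H.integrable_mul_log_one_add)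
  -- First `N → ∞` at fixed `ε`, where `ε ≤ 1` allows domination by `f log (1 + f) + |log ε| f`;
  -- then `f log f ≤ f log (ε + f)`. The limit `ε → 0` comes last.
  have key : ∀ ε : ℝ, 0 < ε → ε ≤ 1 → entropy f ≤ Real.log (ε + 1) + B := by
    intro ε hε hε1
    have hlim : Tendsto (fun N => ∫ x, f x * Real.log (ε + truncation f N x) ∂(gauss n)) atTop
        (𝓝 (∫ x, f x * Real.log (ε + f x) ∂(gauss n))) := by
      refine tendsto_integral_of_dominated_convergence
        (fun x => f x * Real.log (1 + f x) + |Real.log ε| * f x)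
        (fun N => (H.measurable.mul
          ((measurable_truncation H.measurable N).const_add ε).log).aestronglyMeasurable)
        (hdom.add (H.integrable.const_mul _)) (fun N => Eventually.of_forall fun x => ?_)
        (Eventually.of_forall fun x =>
          (((tendsto_truncation x).const_add ε).log (by linarith [H.nonneg x])).const_mul (f x))
      have h0 := truncation_nonneg H.nonneg N x
      have h1 := truncation_le H.nonneg N x
      rw [norm_mul, Real.norm_of_nonneg (H.nonneg x)]
      have h2 : ‖Real.log (ε + truncation f N x)‖ ≤ Real.log (1 + f x) + |Real.log ε| := by
        have a1 := Real.log_le_log hε (show ε ≤ ε + truncation f N x by linarith)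
        have a2 := Real.log_le_log (show 0 < ε + truncation f N x by linarith)
          (show ε + truncation f N x ≤ 1 + f x by linarith)
        have a3 := neg_abs_le (Real.log ε)
        have a4 := abs_nonneg (Real.log ε)
        have a5 := Real.log_nonneg (show 1 ≤ 1 + f x by linarith [H.nonneg x])
        rw [Real.norm_eq_abs, abs_le]
        constructor <;> linarith
      refine (mul_le_mul_of_nonneg_left h2 (H.nonneg x)).trans (le_of_eq ?_)
      ring
    have h1 : ∫ x, f x * Real.log (ε + f x) ∂(gauss n) ≤ Real.log (ε + 1) + B :=
      le_of_tendsto' hlim fun N => H.integral_log_truncation_le hε N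
    refine le_trans ?_ h1
    refine integral_mono H.integrable_mul_log ?_ fun x => ?_
    · refine (hdom.add (H.integrable.const_mul |Real.log ε|)).mono
        (H.measurable.mul (H.measurable.const_add ε).log).aestronglyMeasurable
        (Eventually.of_forall fun x => ?_)
      have h0 := H.nonneg x
      have a1 := Real.log_le_log hε (show ε ≤ ε + f x by linarith)
      have a2 := Real.log_le_log (show 0 < ε + f x by linarith)
        (show ε + f x ≤ 1 + f x by linarith)
      have a3 := neg_abs_le (Real.log ε)
      have a4 := abs_nonneg (Real.log ε)
      have a5 := Real.log_nonneg (show 1 ≤ 1 + f x by linarith)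
      have h2 : ‖Real.log (ε + f x)‖ ≤ Real.log (1 + f x) + |Real.log ε| := by
        rw [Real.norm_eq_abs, abs_le]
        constructor <;> linarith
      rw [norm_mul, Real.norm_of_nonneg h0]
      refine (mul_le_mul_of_nonneg_left h2 h0).trans (le_trans (le_of_eq ?_) (le_abs_self _))
      simp only [Pi.add_apply]
      ring
    · have h0 := H.nonneg x
      rcases h0.eq_or_lt with h | h
      · simp only [← h]; simp
      · exact mul_le_mul_of_nonneg_left (Real.log_le_log h (by linarith)) h0
  have hlim : Tendsto (fun k : ℕ => Real.log (((k : ℝ) + 1)⁻¹ + 1) + B) atTop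
      (𝓝 (Real.log (0 + 1) + B)) := by
    have hk0 : Tendsto (fun k : ℕ => ((k : ℝ) + 1)⁻¹) atTop (𝓝 0) := by
      simpa using tendsto_one_div_add_atTop_nhds_zero_nat (𝕜 := ℝ)
    exact ((hk0.add_const 1).log (by norm_num)).add_const B
  rw [zero_add, Real.log_one, zero_add] at hlim
  refine ge_of_tendsto' hlim fun k => key _ (by positivity) (inv_le_one_of_one_le₀ ?_)
  linarith [Nat.cast_nonneg (α := ℝ) k]

/-! ### From the Fisher information to a weak gradient -/

lemma integrable_of_isProbabilityMeasure {ν : Measure (Euc n)} [IsProbabilityMeasure ν]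
    {f : Euc n → ℝ} (hf_meas : Measurable f) (hf_nonneg : ∀ x, 0 ≤ f x)
    (hν : ν = (gauss n).withDensity (fun x => ENNReal.ofReal (f x))) :
    Integrable f (gauss n) := by
  have := (integrable_density_iff hf_meas hf_nonneg hν (fun _ => 1)).1 (integrable_const 1)
  simpa using this

lemma enorm_sq_div_ofReal (v : Euc n) {a : ℝ} (ha : 0 ≤ a) (h : a = 0 → v = 0) :
    ‖v‖ₑ ^ 2 / ENNReal.ofReal a = ENNReal.ofReal (‖v‖ ^ 2 / a) := by
  rcases ha.eq_or_lt with h0 | hpos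
  · rw [h h0.symm]; simp
  · rw [ENNReal.ofReal_div_of_pos hpos, ENNReal.ofReal_pow (norm_nonneg _), ofReal_norm]

/-- As `a / 0 = ∞` for `a > 0` in the extended integral, finiteness forces `G = 0` almost everywhere
on `{f = 0}`; this reconciles it with real division. Integrability of `G` comes from `‖G‖ ≤ f + ‖G‖²
/ f`. -/
lemma hasFiniteInfo_of_lintegral_ne_top {l : ℝ} {ν : Measure (Euc n)} [IsProbabilityMeasure ν]
    {f : Euc n → ℝ} {G : Euc n → Euc n} (hf_meas : Measurable f) (hf_nonneg : ∀ x, 0 ≤ f x)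
    (hν : ν = (gauss n).withDensity (fun x => ENNReal.ofReal (f x)))
    (hclass : MemPoincareClass l ν) (hcentered : IsCentered ν) (hG : HasWeakGradient f G)
    (hfin : ∫⁻ x, ‖G x‖ₑ ^ 2 / ENNReal.ofReal (f x) ∂(gauss n) ≠ ⊤) :
    HasFiniteInfo l ν f G ∧ ∫ x, ‖G x‖ ^ 2 / f x ∂(gauss n) =
      (∫⁻ x, ‖G x‖ₑ ^ 2 / ENNReal.ofReal (f x) ∂(gauss n)).toReal := by
  have hGm : AEStronglyMeasurable G (gauss n) :=
    hG.locallyIntegrable_grad.aestronglyMeasurable.mono_ac gauss_absolutelyContinuous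
  have hfi := integrable_of_isProbabilityMeasure hf_meas hf_nonneg hν
  have hm : AEMeasurable (fun x => ‖G x‖ₑ ^ 2 / ENNReal.ofReal (f x)) (gauss n) :=
    (hGm.enorm.pow_const 2).div hf_meas.ennreal_ofReal.aemeasurable
  have hzero : ∀ᵐ x ∂(gauss n), f x = 0 → G x = 0 := by
    filter_upwards [ae_lt_top' hm hfin] with x hx h0
    by_contra hne
    rw [h0, ENNReal.ofReal_zero, ENNReal.div_zero (by simpa using hne)] at hx
    exact lt_irrefl _ hx
  have heq : (fun x => ‖G x‖ₑ ^ 2 / ENNReal.ofReal (f x)) =ᵐ[gauss n]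
      fun x => ENNReal.ofReal (‖G x‖ ^ 2 / f x) := by
    filter_upwards [hzero] with x hx using enorm_sq_div_ofReal _ (hf_nonneg x) hx
  have hnn : ∀ x, 0 ≤ ‖G x‖ ^ 2 / f x := fun x => by have := hf_nonneg x; positivity
  have hmr : AEStronglyMeasurable (fun x => ‖G x‖ ^ 2 / f x) (gauss n) :=
    ((hGm.norm.aemeasurable.pow_const 2).div hf_meas.aemeasurable).aestronglyMeasurable
  have hint : Integrable (fun x => ‖G x‖ ^ 2 / f x) (gauss n) := by
    refine ⟨hmr, ?_⟩
    rw [hasFiniteIntegral_iff_ofReal (Eventually.of_forall hnn), ← lintegral_congr_ae heq]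
    exact lt_top_iff_ne_top.2 hfin
  refine ⟨⟨hf_meas, hf_nonneg, hν, hclass, hcentered, hG, ?_, hzero, hint⟩, ?_⟩
  · refine (hfi.add hint).mono hGm ?_
    filter_upwards [hzero] with x hx
    simp only [Pi.add_apply]
    refine le_trans ?_ (le_abs_self _)
    rcases (hf_nonneg x).eq_or_lt with h0 | hpos
    · rw [hx h0.symm, ← h0]; simp
    · have : f x + ‖G x‖ ^ 2 / f x - ‖G x‖ =
          ((f x - ‖G x‖ / 2) ^ 2 + 3 / 4 * ‖G x‖ ^ 2) / f x := by
        field_simp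
        ring
      have h2 : 0 ≤ ((f x - ‖G x‖ / 2) ^ 2 + 3 / 4 * ‖G x‖ ^ 2) / f x := by positivity
      linarith
  · rw [integral_eq_lintegral_of_nonneg_ae (Eventually.of_forall hnn) hmr, lintegral_congr_ae heq]

lemma lsiConst_nonneg {l : ℝ} (hl : 0 < l) : 0 ≤ lsiConst l := by
  by_cases h1 : l = 1
  · simp [lsiConst, h1]
  · simp only [lsiConst, h1, if_false]
    have h2 := mul_le_mul_of_nonneg_left (Real.one_sub_inv_le_log_of_pos hl) hl.le
    rw [mul_sub, mul_inv_cancel₀ hl.ne'] at h2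
    exact div_nonneg (by linarith) (sq_nonneg _)

/-- A weak gradient within `δ` of the infimum is used and then `δ → 0`, so neither uniqueness of the
gradient nor attainment of the infimum is needed. -/
lemma entropy_le_fisherInfo {l : ℝ} {ν : Measure (Euc n)} [IsProbabilityMeasure ν]
    {f : Euc n → ℝ} (hf_meas : Measurable f) (hf_nonneg : ∀ x, 0 ≤ f x)
    (hν : ν = (gauss n).withDensity (fun x => ENNReal.ofReal (f x)))
    (hclass : MemPoincareClass l ν) (hcentered : IsCentered ν) (hfisher : fisherInfo f ≠ ⊤) :
    Integrable (fun x => f x * Real.log (f x)) (gauss n) ∧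
      entropy f ≤ lsiConst l / 2 * (fisherInfo f).toReal := by
  have key : ∀ δ : ℝ, 0 < δ → Integrable (fun x => f x * Real.log (f x)) (gauss n) ∧
      entropy f ≤ lsiConst l / 2 * ((fisherInfo f).toReal + δ) := by
    intro δ hδ
    have hlt : fisherInfo f < fisherInfo f + ENNReal.ofReal δ :=
      ENNReal.lt_add_right hfisher (by simpa using hδ)
    conv_lhs at hlt => rw [fisherInfo]
    obtain ⟨G, hlt⟩ := iInf_lt_iff.1 hlt
    obtain ⟨hG, hlt⟩ := iInf_lt_iff.1 hlt
    obtain ⟨H, hJ⟩ := hasFiniteInfo_of_lintegral_ne_top hf_meas hf_nonneg hν hclass hcentered hG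
      hlt.ne_top
    refine ⟨H.integrable_mul_log, H.entropy_le.trans ?_⟩
    refine mul_le_mul_of_nonneg_left ?_ (div_nonneg (lsiConst_nonneg hclass.pos) zero_le_two)
    rw [hJ, ← ENNReal.toReal_ofReal hδ.le, ← ENNReal.toReal_add hfisher ENNReal.ofReal_ne_top]
    exact ENNReal.toReal_mono (ENNReal.add_ne_top.2 ⟨hfisher, ENNReal.ofReal_ne_top⟩) hlt.le
  refine ⟨(key 1 one_pos).1, ?_⟩
  have hlim : Tendsto (fun k : ℕ => lsiConst l / 2 * ((fisherInfo f).toReal + ((k : ℝ) + 1)⁻¹))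
      atTop (𝓝 (lsiConst l / 2 * ((fisherInfo f).toReal + 0))) := by
    have hk0 : Tendsto (fun k : ℕ => ((k : ℝ) + 1)⁻¹) atTop (𝓝 0) := by
      simpa using tendsto_one_div_add_atTop_nhds_zero_nat (𝕜 := ℝ)
    exact (hk0.const_add _).const_mul _
  rw [add_zero] at hlim
  exact ge_of_tendsto' hlim fun k => (key _ (by positivity)).2

/-! ### Total variation -/

/-- With `s = √a`, one has `|a - 1| = |s - 1| (s + 1)`, and the weighted arithmetic-geometric mean
inequality separates the factors. The Hellinger term `(s - 1)²` is controlled by the entropy through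
`log s ≥ 1 - 1/s`. -/
lemma abs_sub_one_le {a t : ℝ} (ha : 0 ≤ a) (ht : 0 < t) :
    |a - 1| ≤ t / 2 * (a * Real.log a - a + 1) + (a + 1) / t := by
  set s := √a with hs
  have hs0 : 0 ≤ s := Real.sqrt_nonneg a
  have has : a = s ^ 2 := (Real.sq_sqrt ha).symm
  have h1 : (s - 1) ^ 2 ≤ a * Real.log a - a + 1 := by
    rcases hs0.eq_or_lt with h0 | hpos
    · rw [has, ← h0]; simp
    · have h2 := mul_le_mul_of_nonneg_left (Real.one_sub_inv_le_log_of_pos hpos) ha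
      have h3 : a * s⁻¹ = s := by rw [has]; field_simp
      rw [mul_sub, h3] at h2
      have h4 : Real.log a = 2 * Real.log s := by rw [has, Real.log_pow]; norm_num
      rw [h4]
      nlinarith
  have h5 : (s + 1) ^ 2 ≤ 2 * (a + 1) := by rw [has]; nlinarith [sq_nonneg (s - 1)]
  have h6 : |a - 1| = |s - 1| * (s + 1) := by
    rw [has, show s ^ 2 - 1 = (s - 1) * (s + 1) by ring, abs_mul,
      abs_of_nonneg (show 0 ≤ s + 1 by linarith)]
  have h7 : |s - 1| * (s + 1) ≤ t / 2 * (s - 1) ^ 2 + (s + 1) ^ 2 / (2 * t) := by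
    have e : t / 2 * (s - 1) ^ 2 + (s + 1) ^ 2 / (2 * t) - |s - 1| * (s + 1) =
        (t * |s - 1| - (s + 1)) ^ 2 / (2 * t) := by
      rw [← sq_abs (s - 1)]
      field_simp
      ring
    have : 0 ≤ (t * |s - 1| - (s + 1)) ^ 2 / (2 * t) := by positivity
    linarith
  have h8 : (s + 1) ^ 2 / (2 * t) ≤ (a + 1) / t := by
    rw [div_le_div_iff₀ (by positivity) ht]
    nlinarith
  have h9 := mul_le_mul_of_nonneg_left h1 (show 0 ≤ t / 2 by positivity)
  linarith

/-- A Pinsker type inequality. -/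
lemma sq_integral_abs_sub_one_le {f : Euc n → ℝ} (hf_nonneg : ∀ x, 0 ≤ f x)
    (hf : Integrable f (gauss n)) (hf1 : ∫ x, f x ∂(gauss n) = 1)
    (hlog : Integrable (fun x => f x * Real.log (f x)) (gauss n)) :
    (∫ x, |f x - 1| ∂(gauss n)) ^ 2 ≤ 4 * entropy f := by
  set T := ∫ x, |f x - 1| ∂(gauss n) with hT
  have hT0 : 0 ≤ T := integral_nonneg fun x => abs_nonneg _
  have key : ∀ t : ℝ, 0 < t → T ≤ t / 2 * entropy f + 2 / t := by
    intro t ht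
    have i1 : Integrable (fun x => f x * Real.log (f x) - f x + 1) (gauss n) :=
      (hlog.sub hf).add (integrable_const 1)
    have i2 : Integrable (fun x => (f x + 1) / t) (gauss n) :=
      (hf.add (integrable_const 1)).div_const t
    have h := integral_mono (hf.sub (integrable_const 1)).abs ((i1.const_mul (t / 2)).add i2)
      fun x => abs_sub_one_le (hf_nonneg x) ht
    refine h.trans (le_of_eq ?_)
    simp only [Pi.add_apply]
    rw [integral_add (i1.const_mul _) i2, integral_const_mul, integral_div,
      integral_add hf (integrable_const 1),
      integral_add (f := fun x => f x * Real.log (f x) - f x) (hlog.sub hf) (integrable_const 1),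
      integral_sub hlog hf, hf1, integral_const, entropy]
    simp
    ring
  -- If `T = 0`, it remains to see that the entropy is nonnegative, from `f log f ≥ f - 1`.
  -- Otherwise `t = 4 / T` makes the term `2 / t` equal to `T / 2`, which is absorbed on the left.
  rcases hT0.eq_or_lt with h0 | hpos
  · have h2 := integral_mono (hf.sub (integrable_const 1)) hlog fun x => by
      rcases (hf_nonneg x).eq_or_lt with h | h
      · simp [← h]
      · have h3 := mul_le_mul_of_nonneg_left (Real.one_sub_inv_le_log_of_pos h) h.le
        rwa [mul_sub, mul_inv_cancel₀ h.ne', mul_one] at h3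
    simp only [Pi.sub_apply] at h2
    rw [integral_sub hf (integrable_const 1), hf1] at h2
    simp only [integral_const, probReal_univ, smul_eq_mul, mul_one, sub_self] at h2
    change 0 ≤ entropy f at h2
    rw [← h0]
    linarith
  · have h1 := key (4 / T) (by positivity)
    have e : 4 / T / 2 * entropy f + 2 / (4 / T) = (4 * entropy f / T + T) / 2 := by
      field_simp
      ring
    rw [e] at h1
    have h2 : T ≤ 4 * entropy f / T := by linarith
    rw [le_div_iff₀ hpos] at h2
    rw [sq]
    exact h2

/-- The positive and negative parts of `f - 1` are densities of mutually singular measures, so by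
uniqueness they give the Jordan decomposition. -/
lemma tvNorm_eq_integral {ν : Measure (Euc n)} [IsProbabilityMeasure ν] {f : Euc n → ℝ}
    (hf_meas : Measurable f) (hf_nonneg : ∀ x, 0 ≤ f x)
    (hν : ν = (gauss n).withDensity (fun x => ENNReal.ofReal (f x))) :
    tvNorm (ν.toSignedMeasure - (gauss n).toSignedMeasure) = ∫ x, |f x - 1| ∂(gauss n) := by
  have hf := integrable_of_isProbabilityMeasure hf_meas hf_nonneg hν
  have hd : Integrable (fun x => f x - 1) (gauss n) := hf.sub (integrable_const 1)
  have hs : ν.toSignedMeasure - (gauss n).toSignedMeasure =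
      (gauss n).withDensityᵥ (fun x => f x - 1) := by
    ext i hi
    rw [withDensityᵥ_apply hd hi, _root_.sub_apply, Measure.toSignedMeasure_apply_measurable hi,
      Measure.toSignedMeasure_apply_measurable hi, integral_sub hf.integrableOn
      (integrable_const 1).integrableOn]
    congr 1
    · rw [measureReal_def, hν, withDensity_apply _ hi,
        integral_eq_lintegral_of_nonneg_ae (Eventually.of_forall hf_nonneg)
          hf_meas.aestronglyMeasurable]
    · simp
  have := isFiniteMeasure_withDensity_ofReal hd.2
  have := isFiniteMeasure_withDensity_ofReal hd.neg.2
  let j : JordanDecomposition (Euc n) :=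
    { posPart := (gauss n).withDensity fun x => ENNReal.ofReal (f x - 1)
      negPart := (gauss n).withDensity fun x => ENNReal.ofReal (-(f x - 1))
      posPart_finite := isFiniteMeasure_withDensity_ofReal hd.2
      negPart_finite := isFiniteMeasure_withDensity_ofReal hd.neg.2
      mutuallySingular := withDensity_ofReal_mutuallySingular (hf_meas.sub_const 1) }
  have hj : (gauss n).withDensityᵥ (fun x => f x - 1) = j.toSignedMeasure :=
    withDensityᵥ_eq_withDensity_pos_part_sub_withDensity_neg_part hd
  rw [tvNorm, SignedMeasure.totalVariation, hs, SignedMeasure.toJordanDecomposition_eq hj]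
  simp only [j, Measure.add_apply, withDensity_apply _ MeasurableSet.univ, Measure.restrict_univ]
  rw [← lintegral_add_left (hf_meas.sub_const 1).ennreal_ofReal,
    integral_eq_lintegral_of_nonneg_ae (Eventually.of_forall fun x => abs_nonneg _)
      (hf_meas.sub_const 1).abs.aestronglyMeasurable]
  congr 1
  refine lintegral_congr fun x => ?_
  rcases le_total 0 (f x - 1) with h | h
  · rw [abs_of_nonneg h, ENNReal.ofReal_of_nonpos (p := -(f x - 1)) (by linarith), add_zero]
  · rw [abs_of_nonpos h, ENNReal.ofReal_of_nonpos h, zero_add]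

end GaussianLSI

open GaussianLSI in
theorem mainTheorem6 (n : ℕ) (l : ℝ) (ν : Measure (Euc n)) [IsProbabilityMeasure ν]
    (f : Euc n → ℝ) (hf_meas : Measurable f) (hf_nonneg : ∀ x, 0 ≤ f x)
    (hν : ν = (stdGaussian (Euc n)).withDensity (fun x => ENNReal.ofReal (f x)))
    (hclass : MemPoincareClass l ν) (hcentered : IsCentered ν)
    (hfisher : fisherInfo f ≠ ⊤) :
    Integrable (fun x => f x * Real.log (f x)) (stdGaussian (Euc n)) ∧
    lsiDeficit f ≥ lsiConstOne l / 4 * (∫ x, |f x - 1| ∂(stdGaussian (Euc n))) ^ 2 ∧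
    lsiConstOne l / 4 * (∫ x, |f x - 1| ∂(stdGaussian (Euc n))) ^ 2 =
      lsiConstOne l / 4 *
        tvNorm (ν.toSignedMeasure - (stdGaussian (Euc n)).toSignedMeasure) ^ 2 := by
  obtain ⟨hlog, hent⟩ := entropy_le_fisherInfo hf_meas hf_nonneg hν hclass hcentered hfisher
  have hf := integrable_of_isProbabilityMeasure hf_meas hf_nonneg hν
  have hf1 : ∫ x, f x ∂(stdGaussian (Euc n)) = 1 := by
    simpa using (integral_density hf_meas hf_nonneg hν (fun _ => 1)).symm
  refine ⟨hlog, ?_, by rw [tvNorm_eq_integral hf_meas hf_nonneg hν]⟩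
  have hT := sq_integral_abs_sub_one_le hf_nonneg hf hf1 hlog
  have hc1 := lsiConst_le_one hclass.pos
  have hI : 0 ≤ (fisherInfo f).toReal := ENNReal.toReal_nonneg
  have h1 : lsiConst l / 2 * (fisherInfo f).toReal ≤ 1 / 2 * (fisherInfo f).toReal :=
    mul_le_mul_of_nonneg_right (by linarith) hI
  -- The chain `T² ≤ 4 H ≤ 2 I` leaves a factor of two to spare.
  have hT2 : (∫ x, |f x - 1| ∂(stdGaussian (Euc n))) ^ 2 ≤ 4 * (fisherInfo f).toReal := by
    linarith
  have h2 := mul_le_mul_of_nonneg_left hT2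
    (show 0 ≤ lsiConstOne l / 4 by rw [lsiConstOne]; linarith)
  refine h2.trans ?_
  rw [lsiDeficit, lsiConstOne]
  linarith
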